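/- Let $n\ge 2$, $\alpha>0$, $\beta\ge 0$, $\gamma>0$. There are constants $C>0$, $\eta>0$ and $T>0$, depending only on $n,\alpha,\beta,\gamma$, such that the following holds. Let $\rho_0,v_{01},\dots,v_{0n}$ be real-valued functions in $L^2(\mathbf R^n)$ with $$\|f\|_{1,1}:=\int_{\mathbf R^n}(1+|x|)\,|f(x)|\,dx<\infty\qquad (f=\rho_0,v_{01},\dots,v_{0n}),$$ and let $(\rho,v)$, $v=(v_1,\dots,v_n)$, with $\rho,v_j\in C([0,\infty);L^2(\mathbf R^n))$ real-valued, be the solution of the linearized compressible Navier–Stokes system $$\rho_t+\gamma\,\mathrm{div}\,v=0,\qquad v_t-\alpha\Delta v-\beta\nabla\mathrm{div}\,v+\gamma\nabla\rho=0\qquad (t>0,\ x\in\mathbf R^n),\qquad \rho(0)=\rho_0,\quad v(0)=v_0,$$ where the equations hold for every $t>0$ in the sense of tempered distributions on $\mathbf R^n$. Put $P_0:=\int_{\mathbf R^n}v_0(x)\,dx\in\mathbf R^n$, $Q_0:=\int_{\mathbf R^n}\rho_0(x)\,dx$, write $\|\cdot\|$ for the $L^2(\mathbf R^n)$ norm,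 $\|v_0\|^2=\sum_j\|v_{0j}\|^2$, and let $\hat v(t,\xi)$ be the Fourier transform of $v(t,\cdot)$, normalized on $L^1\cap L^2$ by $\hat f(\xi)=\int_{\mathbf R^n}e^{-ix\cdot\xi}f(x)\,dx$ (and extended to $L^2$). Then for all $t\ge T$ $$\int_{\mathbf R^n}\Big|\hat v(t,\xi)-P_0e^{-\alpha|\xi|^2t}+\frac{\xi(\xi\cdot P_0)}{|\xi|^2}e^{-\alpha|\xi|^2t}+i\xi\,e^{-\frac{(\alpha+\beta)|\xi|^2t}{2}}\frac{\sin(\gamma t|\xi|)}{|\xi|}Q_0-\frac{\xi(\xi\cdot P_0)}{|\xi|^2}e^{-\frac{(\alpha+\beta)|\xi|^2t}{2}}\cos(\gamma t|\xi|)\Big|^2d\xi$$ $$\le C\Big(|P_0|^2+|Q_0|^2+\sum_{j=1}^n\|v_{0j}\|_{1,1}^2+\|\rho_0\|_{1,1}^2\Big)t^{-\frac n2-1}+Ce^{-\eta t}\big(\|v_0\|^2+\|\rho_0\|^2\big).$$ -/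

import Mathlib

open MeasureTheory
open scoped FourierTransform LineDeriv SchwartzMap

noncomputable section

namespace LinNS

/-- The space `ℝⁿ` with its Euclidean norm. -/
abbrev Sp (n : ℕ) : Type := EuclideanSpace ℝ (Fin n)

/-- The space `L²(ℝⁿ)` of real-valued functions. -/
abbrev L2 (n : ℕ) : Type := Lp ℝ 2 (volume : Measure (Sp n))

/-- The partial derivative `∂φ/∂x_j` of a Schwartz function. -/
def pd {n : ℕ} (j : Fin n) (φ : 𝓢(Sp n, ℂ)) : 𝓢(Sp n, ℂ) :=
  ∂_{EuclideanSpace.single j (1 : ℝ)} φ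

/-- The pairing `∫ f(x) φ(x) dx` of an `L²` function with a Schwartz function. -/
def pair {n : ℕ} (f : L2 n) (φ : 𝓢(Sp n, ℂ)) : ℂ :=
  ∫ x, (f x : ℂ) * φ x

/-- `(ρ, v)` is a solution of the Cauchy problem
`ρ_t + γ div v = 0`, `v_t - α Δ v - β ∇ div v + γ ∇ ρ = 0`, `(ρ, v)(0) = (ρ₀, v₀)`:
the curves `ρ, v₁, …, vₙ` are in `C([0,∞); L²(ℝⁿ))`, the initial data are attained, and for
every `t > 0` both equations hold in the sense of tempered distributions on `ℝⁿ`. -/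
structure IsSolution {n : ℕ} (α β γ : ℝ) (ρ₀ : Sp n → ℝ) (v₀ : Fin n → Sp n → ℝ)
    (ρ : ℝ → L2 n) (v : ℝ → Fin n → L2 n) : Prop where
  continuousOn_density : ContinuousOn ρ (Set.Ici 0)
  continuousOn_velocity : ∀ j, ContinuousOn (fun t => v t j) (Set.Ici 0)
  initial_density : ρ 0 =ᵐ[volume] ρ₀
  initial_velocity : ∀ j, v 0 j =ᵐ[volume] v₀ j
  continuity_equation : ∀ t : ℝ, 0 < t → ∀ φ : 𝓢(Sp n, ℂ),
    HasDerivAt (fun s => pair (ρ s) φ) (γ * (∑ k, pair (v t k) (pd k φ))) t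
  momentum_equation : ∀ t : ℝ, 0 < t → ∀ (j : Fin n) (φ : 𝓢(Sp n, ℂ)),
    HasDerivAt (fun s => pair (v s j) φ)
      (α * (∑ k, pair (v t j) (pd k (pd k φ))) + β * (∑ k, pair (v t k) (pd k (pd j φ)))
        + γ * pair (ρ t) (pd j φ)) t

/-- The (Plancherel) Fourier transform on `L²(ℝⁿ)` which on `L¹ ∩ L²` is
`f̂(ξ) = ∫ e^{-i x·ξ} f(x) dx`. It is obtained from Mathlib's transform, whose kernel is
`e^{-2πi x·ξ}`, by rescaling the frequency. -/
def fourierL2 {n : ℕ} (f : L2 n) (ξ : Sp n) : ℂ :=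
  (𝓕 (Complex.ofRealCLM.compLp f : Lp ℂ 2 (volume : Measure (Sp n))) :
    Lp ℂ 2 (volume : Measure (Sp n))) ((2 * Real.pi)⁻¹ • ξ)

/-- Membership in the weighted space `L^{1,1}(ℝⁿ)`. -/
def MemL11 {n : ℕ} (f : Sp n → ℝ) : Prop :=
  Integrable f ∧ Integrable (fun x => (1 + ‖x‖) * |f x|)

/-- The norm `‖f‖_{1,1} = ∫ (1 + |x|) |f(x)| dx`. -/
def norm11 {n : ℕ} (f : Sp n → ℝ) : ℝ := ∫ x, (1 + ‖x‖) * |f x|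

/-- The `L²(ℝⁿ)` norm. -/
def norm2 {n : ℕ} (f : Sp n → ℝ) : ℝ := (eLpNorm f 2 volume).toReal

/-- The `j`-th component of the profile
`P e^{-α|ξ|²t} - (ξ(ξ·P)/|ξ|²) e^{-α|ξ|²t} - iξ e^{-(α+β)|ξ|²t/2} (sin(γt|ξ|)/|ξ|) Q
  + (ξ(ξ·P)/|ξ|²) e^{-(α+β)|ξ|²t/2} cos(γt|ξ|)`, for `ξ ≠ 0`. -/
def profile {n : ℕ} (α β γ : ℝ) (P : Fin n → ℝ) (Q : ℝ) (t : ℝ) (ξ : Sp n) (j : Fin n) : ℂ :=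
  ((P j * Real.exp (-α * ‖ξ‖ ^ 2 * t) : ℝ) : ℂ)
    - ((ξ j * (∑ k, ξ k * P k) / ‖ξ‖ ^ 2 * Real.exp (-α * ‖ξ‖ ^ 2 * t) : ℝ) : ℂ)
    - Complex.I * ((ξ j * Real.exp (-(α + β) * ‖ξ‖ ^ 2 * t / 2)
        * (Real.sin (γ * t * ‖ξ‖) / ‖ξ‖) * Q : ℝ) : ℂ)
    + ((ξ j * (∑ k, ξ k * P k) / ‖ξ‖ ^ 2 * Real.exp (-(α + β) * ‖ξ‖ ^ 2 * t / 2)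
        * Real.cos (γ * t * ‖ξ‖) : ℝ) : ℂ)

/-- The squared Euclidean distance `|v̂(t,ξ) - profile(t,ξ)|²`, where `P₀ⱼ = ∫ v₀ⱼ` and
`Q₀ = ∫ ρ₀`, and `w` stands for `v(t,·)`. -/
def errorSq {n : ℕ} (α β γ : ℝ) (ρ₀ : Sp n → ℝ) (v₀ : Fin n → Sp n → ℝ)
    (w : Fin n → L2 n) (t : ℝ) (ξ : Sp n) : ℝ :=
  ∑ j, ‖fourierL2 (w j) ξ
    - profile α β γ (fun k => ∫ x, v₀ k x) (∫ x, ρ₀ x) t ξ j‖ ^ 2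

end LinNS

end

/-! The Fourier transform turns the system into a linear differential equation at each frequency
`ξ`. To justify this for weak solutions, cut off in frequency: on a compact set the symbol is a
bounded multiplication operator on `L²`, so the truncated solution is its exponential applied to the
truncated data.

At a fixed `ξ` the velocity splits into a part orthogonal to `ξ`, which decays like `e^{-α|ξ|²t}`,
and a part along `ξ`, coupled to the density as a damped oscillator with damping `ν|ξ|²/2`, where
`ν = α + β`, and frequency `ω = √(γ²|ξ|² - ν²|ξ|⁴/4)`. For `ν|ξ| ≤ γ` one has `ω = γ|ξ| + O(|ξ|³)`,
and replacing `ω` by `γ|ξ|` and the transformed data by their values at `ξ = 0` costs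
`O(|ξ|(1 + |ξ|²t) e^{-ν|ξ|²t/2})` times the `L^{1,1}` norms of the data. For `ν|ξ| ≥ γ` the energy,
corrected by an interaction term, decays exponentially at a rate independent of `ξ`. Integration of
the squared bounds gives `t^{-n/2-1}` from the second moment of a Gaussian, and the exponential term
from Plancherel's theorem. -/

noncomputable section

namespace LinNS

open Filter Topology Set
open scoped ENNReal

section Multiplication

variable {X E : Type*} [MeasurableSpace X] {μ : Measure X} [NormedAddCommGroup E]
  [NormedSpace ℝ E] {p : ℝ≥0∞}

lemma coeFn_finset_sum_smul {ι : Type*} (s : Finset ι) (a : ι → ℝ) (f : ι → Lp E p μ) :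
    (∑ k ∈ s, a k • f k : Lp E p μ) =ᵐ[μ] fun x => ∑ k ∈ s, a k • f k x := by
  filter_upwards [Lp.coeFn_finsetSum s fun k => a k • f k,
    (ae_ball_iff s.countable_toSet).2 fun k _ => Lp.coeFn_smul (a k) (f k)] with x hsum hsmul
  rw [hsum, Finset.sum_apply]
  exact Finset.sum_congr rfl fun k hk => hsmul k hk

variable [Fact (1 ≤ p)]

/-- The operator of multiplication by an essentially bounded operator-valued function on `Lᵖ`. -/
def lpMul (M : Lp (E →L[ℝ] E) ∞ μ) : Lp E p μ →L[ℝ] Lp E p μ :=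
  (ContinuousLinearMap.id ℝ (E →L[ℝ] E)).holderL μ ∞ p p M

lemma coeFn_lpMul (M : Lp (E →L[ℝ] E) ∞ μ) (f : Lp E p μ) :
    lpMul M f =ᵐ[μ] fun x => M x (f x) :=
  (ContinuousLinearMap.id ℝ (E →L[ℝ] E)).coeFn_holder (r := p) M f

lemma coeFn_lpMul_pow (M : Lp (E →L[ℝ] E) ∞ μ) (f : Lp E p μ) (k : ℕ) :
    (lpMul M ^ k) f =ᵐ[μ] fun x => (M x ^ k) (f x) := by
  induction k with
  | zero => simp
  | succ k ih =>
    filter_upwards [ih, coeFn_lpMul M ((lpMul M ^ k) f)] with x hk hM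
    rw [pow_succ', pow_succ', mul_apply_eq_comp, mul_apply_eq_comp, hM, hk]

lemma tendsto_sum_exp_smul_apply [CompleteSpace E] (A : E →L[ℝ] E) (t : ℝ) (y : E) :
    Tendsto (fun N : ℕ => ∑ k ∈ Finset.range N, ((k.factorial : ℝ)⁻¹ * t ^ k) • (A ^ k) y)
      atTop (𝓝 (NormedSpace.exp (t • A) y)) := by
  have hexp := (NormedSpace.exp_series_hasSum_exp' (𝕂 := ℝ) (t • A)).tendsto_sum_nat
  refine (((ContinuousLinearMap.apply ℝ E y).continuous.tendsto _).comp hexp).congr fun N => ?_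
  simp [smul_pow, smul_smul]

/-- The exponential series converges in `Lᵖ`, hence almost everywhere along a subsequence. -/
lemma coeFn_exp_smul_lpMul [CompleteSpace E] (M : Lp (E →L[ℝ] E) ∞ μ) (f : Lp E p μ) (t : ℝ) :
    NormedSpace.exp (t • lpMul M) f =ᵐ[μ] fun x => NormedSpace.exp (t • M x) (f x) := by
  obtain ⟨ns, hns, hae⟩ := (tendstoInMeasure_of_tendsto_Lp
    (tendsto_sum_exp_smul_apply (lpMul M) t f)).exists_seq_tendsto_ae
  filter_upwards [hae, ae_all_iff.2 fun N => coeFn_finset_sum_smul (Finset.range N)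
      (fun k => (k.factorial : ℝ)⁻¹ * t ^ k) (fun k => (lpMul M ^ k) f),
    ae_all_iff.2 (coeFn_lpMul_pow M f)] with x hlim hsum hpow
  refine tendsto_nhds_unique hlim
    (((tendsto_sum_exp_smul_apply (M x) t (f x)).comp hns.tendsto_atTop).congr fun N => ?_)
  simp only [Function.comp_apply, hsum, hpow]

end Multiplication

lemma exp_zero_smul_apply {H : Type*} [NormedAddCommGroup H] [NormedSpace ℝ H] (A : H →L[ℝ] H)
    (y : H) : NormedSpace.exp ((0 : ℝ) • A) y = y := by
  rw [zero_smul, NormedSpace.exp_zero]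
  rfl

lemma eq_exp_smul_of_hasDerivAt {H : Type*} [NormedAddCommGroup H] [NormedSpace ℝ H]
    [CompleteSpace H] (A : H →L[ℝ] H) {V : ℝ → H} (hc : ContinuousOn V (Ici 0))
    (hd : ∀ t, 0 < t → HasDerivAt V (A (V t)) t) {t : ℝ} (ht : 0 ≤ t) :
    V t = NormedSpace.exp (t • A) (V 0) := by
  have hE (s : ℝ) : HasDerivAt (fun s : ℝ => NormedSpace.exp ((t - s) • A))
      (-(NormedSpace.exp ((t - s) • A) * A)) s := by
    simpa [Function.comp_def] using
      (hasDerivAt_exp_smul_const (𝕂 := ℝ) A (t - s)).scomp s ((hasDerivAt_id s).const_sub t)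
  have hZc : ContinuousOn (fun s => NormedSpace.exp ((t - s) • A) (V s)) (Icc 0 t) := fun s hs =>
    (hE s).continuousAt.continuousWithinAt.clm_apply ((hc s hs.1).mono Icc_subset_Ici_self)
  have hZd (s : ℝ) (hs : s ∈ Ioo 0 t) :
      HasDerivAt (fun s => NormedSpace.exp ((t - s) • A) (V s)) 0 s := by
    simpa using (hE s).clm_apply (hd s hs.1)
  simpa [NormedSpace.exp_zero, sub_eq_zero] using
    (intervalIntegral.integral_eq_sub_of_hasDerivAt_of_le ht hZc hZd (by simp)).symm

lemma memLp_top_indicator_tsupport {X F : Type*} [TopologicalSpace X] [MeasurableSpace X]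
    [BorelSpace X] [NormedAddCommGroup F] {μ : Measure X} {M : X → F} {c : X → ℝ}
    (hM : ContinuousOn M (tsupport c)) (hm : AEStronglyMeasurable M μ)
    (hc : HasCompactSupport c) : MemLp ((tsupport c).indicator M) ∞ μ := by
  obtain ⟨B, hB⟩ := hc.isCompact.exists_bound_of_continuousOn hM
  refine memLp_top_of_bound (hm.indicator (isClosed_tsupport c).measurableSet) (max B 0)
    (ae_of_all _ fun x => ?_)
  rw [norm_indicator_eq_indicator_norm]
  exact indicator_le' (fun x hx => (hB x hx).trans (le_max_left B 0))
    (fun _ _ => le_max_right B 0) x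

section WeakEquation

open scoped ContDiff

variable {X E : Type*} [NormedAddCommGroup X] [MeasurableSpace X] [BorelSpace X]
  {μ : Measure X} [IsFiniteMeasureOnCompacts μ] [NormedAddCommGroup E] [NormedSpace ℝ E]
  [CompleteSpace E]

/-- The functional `f ↦ ∫ g f` on `L²` given by a test function `g`. -/
def testL {g : X → ℝ} (hg : Continuous g) (hg' : HasCompactSupport g) :
    Lp E 2 μ →L[ℝ] E :=
  (ContinuousLinearMap.lsmul ℝ ℝ).lpPairing μ 2 2 (hg.memLp_of_hasCompactSupport hg').toLp

lemma testL_apply {g : X → ℝ} (hg : Continuous g) (hg' : HasCompactSupport g) (f : Lp E 2 μ) :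
    testL hg hg' f = ∫ x, g x • f x ∂μ := by
  rw [testL, ContinuousLinearMap.lpPairing_eq_integral]
  refine integral_congr_ae ?_
  filter_upwards [(hg.memLp_of_hasCompactSupport (μ := μ) (p := 2) hg').coeFn_toLp] with x hx
  simp [hx]

variable [NormedSpace ℝ X] [FiniteDimensional ℝ X]

lemma eq_of_forall_testL_eq {f₁ f₂ : Lp E 2 μ}
    (h : ∀ g : X → ℝ, (hg : ContDiff ℝ ∞ g) → (hg' : HasCompactSupport g) →
      testL hg.continuous hg' f₁ = testL hg.continuous hg' f₂) : f₁ = f₂ := by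
  refine Lp.ext (ae_eq_of_integral_contDiff_smul_eq ((Lp.memLp f₁).locallyIntegrable one_le_two)
    ((Lp.memLp f₂).locallyIntegrable one_le_two) fun g hg hg' => ?_)
  rw [← testL_apply hg.continuous hg', ← testL_apply hg.continuous hg', h g hg hg']

lemma hasDerivAt_of_forall_testL {f f' : ℝ → Lp E 2 μ} (hf' : ContinuousOn f' (Ioi 0))
    (h : ∀ t, 0 < t → ∀ g : X → ℝ, (hg : ContDiff ℝ ∞ g) → (hg' : HasCompactSupport g) →
      HasDerivAt (fun s => testL hg.continuous hg' (f s)) (testL hg.continuous hg' (f' t)) t)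
    {t : ℝ} (ht : 0 < t) : HasDerivAt f (f' t) t := by
  have hsub (s : ℝ) (hs : 0 < s) : uIcc t s ⊆ Ioi 0 := fun x hx => (lt_min ht hs).trans_le hx.1
  have hFTC (s : ℝ) (hs : 0 < s) : f s = f t + ∫ τ in t..s, f' τ := by
    refine eq_of_forall_testL_eq fun g hg hg' => ?_
    set ℓ := testL (E := E) (μ := μ) hg.continuous hg'
    have hcont : ContinuousOn f' (uIcc t s) := hf'.mono (hsub s hs)
    rw [map_add, ← ℓ.intervalIntegral_comp_comm hcont.intervalIntegrable,
      intervalIntegral.integral_eq_sub_of_hasDerivAt (fun x hx => h x (hsub s hs hx) g hg hg')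
        (ℓ.continuous.comp_continuousOn hcont).intervalIntegrable]
    abel
  have hprim : HasDerivAt (fun s => ∫ τ in t..s, f' τ) (f' t) t :=
    intervalIntegral.integral_hasDerivAt_right (by simp)
      (hf'.stronglyMeasurableAtFilter isOpen_Ioi _ ht) (hf'.continuousAt (Ioi_mem_nhds ht))
  refine (hprim.const_add (f t)).congr_of_eventuallyEq ?_
  filter_upwards [Ioi_mem_nhds ht] with s hs using hFTC s hs

/-- Multiplication by a compactly supported scalar `c` commutes with `M` and makes it bounded:
the truncation `c u` solves a linear equation in `L²` with the bounded operator `1_K M`, where `K`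
is the support of `c`. -/
lemma ae_eq_exp_of_weak_of_ne_zero {M : X → E →L[ℝ] E} (hM : Continuous M) {u : ℝ → Lp E 2 μ}
    (hc : ContinuousOn u (Ici 0))
    (hu : ∀ t, 0 < t → ∀ g : X → ℝ, ContDiff ℝ ∞ g → HasCompactSupport g →
      HasDerivAt (fun s => ∫ x, g x • u s x ∂μ) (∫ x, g x • M x (u t x) ∂μ) t)
    {c : X → ℝ} (hcd : ContDiff ℝ ∞ c) (hcs : HasCompactSupport c) {t : ℝ} (ht : 0 ≤ t) :
    ∀ᵐ x ∂μ, c x ≠ 0 → u t x = NormedSpace.exp (t • M x) (u 0 x) := by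
  have hcM : MemLp (fun x => c x • ContinuousLinearMap.id ℝ E) ∞ μ :=
    (hcd.continuous.smul continuous_const).memLp_of_hasCompactSupport hcs.smul_right
  have hKM : MemLp ((tsupport c).indicator M) ∞ μ :=
    memLp_top_indicator_tsupport hM.continuousOn hM.aestronglyMeasurable hcs
  set V : ℝ → Lp E 2 μ := fun s => lpMul hcM.toLp (u s)
  set A : Lp E 2 μ →L[ℝ] Lp E 2 μ := lpMul hKM.toLp
  have hV (s : ℝ) : V s =ᵐ[μ] fun x => c x • u s x := by
    filter_upwards [coeFn_lpMul hcM.toLp (u s), hcM.coeFn_toLp] with x h h'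
    simp [V, h, h']
  have hVc : ContinuousOn V (Ici 0) := (lpMul hcM.toLp).continuous.comp_continuousOn hc
  have hAV (s : ℝ) : A (V s) =ᵐ[μ] fun x => c x • M x (u s x) := by
    filter_upwards [coeFn_lpMul hKM.toLp (V s), hKM.coeFn_toLp, hV s] with x h h' hVx
    by_cases hx : x ∈ tsupport c
    · simp [A, h, h', hVx, hx]
    · simp [A, h, h', hVx, hx, image_eq_zero_of_notMem_tsupport hx]
  have hVd (s : ℝ) (hs : 0 < s) : HasDerivAt V (A (V s)) s := by
    refine hasDerivAt_of_forall_testL (f' := fun s => A (V s))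
      (A.continuous.comp_continuousOn (hVc.mono Ioi_subset_Ici_self)) (fun s hs g hg hg' => ?_) hs
    convert hu s hs (fun x => g x * c x) (hg.mul hcd) hg'.mul_right using 1
    · funext r
      rw [testL_apply]
      refine integral_congr_ae ?_
      filter_upwards [hV r] with x hx
      rw [hx, smul_smul]
    · rw [testL_apply]
      refine integral_congr_ae ?_
      filter_upwards [hAV s] with x hx
      rw [hx, smul_smul]
  have hexp := eq_exp_smul_of_hasDerivAt A hVc hVd ht
  filter_upwards [hV t, hV 0, coeFn_exp_smul_lpMul hKM.toLp (V 0) t, hKM.coeFn_toLp]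
    with x hVt hV0 hE hMx hcx
  rw [← hexp, hVt, hMx, indicator_of_mem (subset_tsupport c hcx), hV0, map_smul] at hE
  exact smul_right_injective E hcx hE

theorem ae_eq_exp_of_weak {M : X → E →L[ℝ] E} (hM : Continuous M) {u : ℝ → Lp E 2 μ}
    (hc : ContinuousOn u (Ici 0))
    (hu : ∀ t, 0 < t → ∀ g : X → ℝ, ContDiff ℝ ∞ g → HasCompactSupport g →
      HasDerivAt (fun s => ∫ x, g x • u s x ∂μ) (∫ x, g x • M x (u t x) ∂μ) t)
    {t : ℝ} (ht : 0 ≤ t) :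
    ∀ᵐ x ∂μ, u t x = NormedSpace.exp (t • M x) (u 0 x) := by
  let χ (R : ℕ) : ContDiffBump (0 : X) := ⟨R + 1, R + 2, by positivity, by linarith⟩
  filter_upwards [ae_all_iff.2 fun R =>
    ae_eq_exp_of_weak_of_ne_zero hM hc hu (χ R).contDiff (χ R).hasCompactSupport ht] with x hx
  obtain ⟨R, hR⟩ := exists_nat_gt ‖x‖
  refine hx R ((χ R).pos_of_mem_ball ?_).ne'
  simp only [χ, mem_ball_zero_iff]
  linarith

end WeakEquation

section FourierSide

open scoped ContDiff

variable {n : ℕ}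

/-- The space `L²(ℝⁿ)` of complex-valued functions. -/
abbrev CL2 (n : ℕ) : Type := Lp ℂ 2 (volume : Measure (Sp n))

/-- The values of the pair (density, velocity) on the Fourier side. -/
abbrev ModeState (n : ℕ) : Type := ℂ × (Fin n → ℂ)

/-- The product `ξ · a` of a frequency with a complex vector. -/
def freqDot (ξ : Sp n) (a : Fin n → ℂ) : ℂ := ∑ k, ξ k * a k

lemma freqDot_ofReal (ξ : Sp n) (P : Fin n → ℝ) :
    freqDot ξ (fun k => (P k : ℂ)) = ((∑ k, ξ k * P k : ℝ) : ℂ) := by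
  simp [freqDot]

lemma sum_coord_sq (ξ : Sp n) : ∑ k, ξ k ^ 2 = ‖ξ‖ ^ 2 := by
  rw [EuclideanSpace.norm_sq_eq]
  simp

/-- The symbol of the spatial part of the system at the frequency `ξ`. -/
def symbol (α β γ : ℝ) (ξ : Sp n) : ModeState n →L[ℝ] ModeState n :=
  LinearMap.toContinuousLinearMap
    { toFun y := (-(Complex.I * γ * freqDot ξ y.2), fun j => -(α * (‖ξ‖ : ℂ) ^ 2 * y.2 j)
        - β * ξ j * freqDot ξ y.2 - Complex.I * γ * ξ j * y.1)
      map_add' y z := by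
        ext <;> simp only [freqDot, Prod.fst_add, Prod.snd_add, Pi.add_apply, mul_add,
          Finset.sum_add_distrib] <;> ring
      map_smul' c y := by
        ext <;> simp only [freqDot, Prod.smul_fst, Prod.smul_snd, Pi.smul_apply, Complex.real_smul,
          RingHom.id_apply, mul_left_comm _ (c : ℂ), ← Finset.mul_sum] <;> ring }

lemma symbol_apply (α β γ : ℝ) (ξ : Sp n) (y : ModeState n) :
    symbol α β γ ξ y = (-(Complex.I * γ * freqDot ξ y.2), fun j => -(α * (‖ξ‖ : ℂ) ^ 2 * y.2 j)
      - β * ξ j * freqDot ξ y.2 - Complex.I * γ * ξ j * y.1) :=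
  rfl

lemma continuous_symbol (α β γ : ℝ) : Continuous (symbol α β γ : Sp n → _) := by
  refine continuous_clm_apply.2 fun y => ?_
  simp only [symbol_apply, freqDot]
  fun_prop

/-- The complexification of a real `L²` function. -/
def toC (f : L2 n) : CL2 n := Complex.ofRealCLM.compLp f

lemma coeFn_toC (f : L2 n) : toC f =ᵐ[volume] fun x => (f x : ℂ) :=
  Complex.ofRealCLM.coeFn_compLp f

lemma continuous_fourier_toC : Continuous fun f : L2 n => (𝓕 (toC f) : CL2 n) :=
  (FourierTransform.fourierCLM ℂ (CL2 n)).continuous.comp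
    (Complex.ofRealCLM.compLpL 2 volume).continuous

lemma pair_fourier (f : L2 n) (φ : 𝓢(Sp n, ℂ)) :
    pair f (𝓕 φ) = ∫ x, φ x * (𝓕 (toC f) : CL2 n) x := by
  have h := DFunLike.congr_fun (Lp.fourier_toTemperedDistribution_eq (toC f)) φ
  rw [TemperedDistribution.fourier_apply, Lp.toTemperedDistribution_apply,
    Lp.toTemperedDistribution_apply] at h
  rw [pair]
  refine (integral_congr_ae ?_).trans h
  filter_upwards [coeFn_toC f] with x hx
  rw [hx, smul_eq_mul, mul_comm]

/-- The multiplier of `∂_k` acting on Fourier transforms of test functions, in the normalization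
with kernel `e^{-2πi x·ξ}`. -/
def coordMul (k : Fin n) (x : Sp n) : ℂ := -(Complex.I * ((2 * Real.pi) • x) k)

lemma coordMul_hasTemperateGrowth (k : Fin n) : (coordMul (n := n) k).HasTemperateGrowth :=
  (-(Complex.I • (Complex.ofRealCLM.comp
    (EuclideanSpace.proj (𝕜 := ℝ) k : Sp n →L[ℝ] ℝ)).comp
      ((2 * Real.pi) • ContinuousLinearMap.id ℝ (Sp n)))).hasTemperateGrowth

/-- Multiplication of a test function by `coordMul k`. -/
def mulCoord (k : Fin n) (φ : 𝓢(Sp n, ℂ)) : 𝓢(Sp n, ℂ) :=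
  SchwartzMap.smulLeftCLM ℂ (coordMul k) φ

lemma mulCoord_apply (k : Fin n) (φ : 𝓢(Sp n, ℂ)) (x : Sp n) :
    mulCoord k φ x = coordMul k x * φ x :=
  SchwartzMap.smulLeftCLM_apply_apply (coordMul_hasTemperateGrowth k) φ x

lemma pd_fourier (k : Fin n) (φ : 𝓢(Sp n, ℂ)) : pd k (𝓕 φ) = 𝓕 (mulCoord k φ) := by
  rw [pd, SchwartzMap.lineDerivOp_fourier_eq]
  congr 1
  ext x
  have h : (inner ℝ · (EuclideanSpace.single k (1 : ℝ)) : Sp n → ℝ).HasTemperateGrowth :=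
    ((innerSL ℝ).flip _).hasTemperateGrowth
  rw [mulCoord_apply, smul_apply, SchwartzMap.smulLeftCLM_apply_apply h]
  simp [coordMul, EuclideanSpace.inner_single_right]
  ring

lemma symbol_two_pi_smul (α β γ : ℝ) (x : Sp n) (y : ModeState n) :
    symbol α β γ ((2 * Real.pi) • x) y
      = (γ * ∑ k, coordMul k x * y.2 k, fun j => α * (∑ k, coordMul k x * (coordMul k x * y.2 j))
          + β * (∑ k, coordMul k x * (coordMul j x * y.2 k)) + γ * (coordMul j x * y.1)) := by
  have hdot : ∑ k, coordMul k x * y.2 k = -(Complex.I * freqDot ((2 * Real.pi) • x) y.2) := by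
    simp only [coordMul, freqDot, Finset.mul_sum, ← Finset.sum_neg_distrib]
    exact Finset.sum_congr rfl fun k _ => by ring
  have hsq : ∑ k, coordMul k x * coordMul k x = -(‖(2 * Real.pi) • x‖ : ℂ) ^ 2 := by
    rw [← Complex.ofReal_pow, ← sum_coord_sq, Complex.ofReal_sum, ← Finset.sum_neg_distrib]
    refine Finset.sum_congr rfl fun k _ => ?_
    simp only [coordMul, Complex.ofReal_pow]
    linear_combination (((2 * Real.pi) • x) k : ℂ) ^ 2 * Complex.I_sq
  refine Prod.ext ?_ (funext fun j => ?_)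
  · rw [hdot, symbol_apply]
    ring
  · have hα : ∑ k, coordMul k x * (coordMul k x * y.2 j)
        = -(‖(2 * Real.pi) • x‖ : ℂ) ^ 2 * y.2 j := by
      rw [← hsq, Finset.sum_mul]
      exact Finset.sum_congr rfl fun k _ => by ring
    have hβ : ∑ k, coordMul k x * (coordMul j x * y.2 k)
        = coordMul j x * -(Complex.I * freqDot ((2 * Real.pi) • x) y.2) := by
      rw [← hdot, Finset.mul_sum]
      exact Finset.sum_congr rfl fun k _ => by ring
    simp only [hα, hβ, symbol_apply]
    simp only [coordMul]
    linear_combination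
      -β * ((2 * Real.pi) • x) j * freqDot ((2 * Real.pi) • x) y.2 * Complex.I_sq

/-- The `L²` function with values in `ModeState n` which has the given components. -/
def assemble (r : CL2 n) (w : Fin n → CL2 n) : Lp (ModeState n) 2 (volume : Measure (Sp n)) :=
  (ContinuousLinearMap.inl ℝ ℂ (Fin n → ℂ)).compLpL 2 volume r
    + ∑ j, ((ContinuousLinearMap.inr ℝ ℂ (Fin n → ℂ)).comp
      (ContinuousLinearMap.single ℝ (fun _ : Fin n => ℂ) j)).compLpL 2 volume (w j)

lemma coeFn_assemble (r : CL2 n) (w : Fin n → CL2 n) :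
    assemble r w =ᵐ[volume] fun x => (r x, fun j => w j x) := by
  let ι (j : Fin n) := (ContinuousLinearMap.inr ℝ ℂ (Fin n → ℂ)).comp
    (ContinuousLinearMap.single ℝ (fun _ : Fin n => ℂ) j)
  filter_upwards [Lp.coeFn_add ((ContinuousLinearMap.inl ℝ ℂ (Fin n → ℂ)).compLpL 2 volume r)
      (∑ j, (ι j).compLpL 2 volume (w j)),
    Lp.coeFn_finsetSum Finset.univ (fun j => (ι j).compLpL 2 volume (w j)),
    (ContinuousLinearMap.inl ℝ ℂ (Fin n → ℂ)).coeFn_compLpL r,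
    ae_all_iff.2 fun j => (ι j).coeFn_compLpL (w j)] with x hadd hsum hr hw
  rw [assemble, hadd, Pi.add_apply, hsum, Finset.sum_apply, hr,
    Finset.sum_congr rfl fun j _ => hw j]
  ext j <;> simp [ι, Prod.fst_sum, Prod.snd_sum, Pi.single_apply]

lemma continuousOn_assemble {s : Set ℝ} {r : ℝ → CL2 n} {w : ℝ → Fin n → CL2 n}
    (hr : ContinuousOn r s) (hw : ∀ j, ContinuousOn (fun t => w t j) s) :
    ContinuousOn (fun t => assemble (r t) (w t)) s :=
  (ContinuousLinearMap.continuous _).comp_continuousOn hr |>.add <|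
    continuousOn_finsetSum _ fun j _ => (ContinuousLinearMap.continuous _).comp_continuousOn (hw j)

lemma integrable_schwartz_mul (φ : 𝓢(Sp n, ℂ)) (f : CL2 n) :
    Integrable (fun x => φ x * f x) volume :=
  (φ.memLp 2 volume).integrable_mul (Lp.memLp f)

/-- The Fourier transform of `(ρ, v)`, as one vector-valued function. -/
def fourierState (r : L2 n) (w : Fin n → L2 n) : Lp (ModeState n) 2 (volume : Measure (Sp n)) :=
  assemble (𝓕 (toC r)) fun j => 𝓕 (toC (w j))

lemma integral_smul_fourierState {g : Sp n → ℝ} {φ : 𝓢(Sp n, ℂ)} (hφ : ∀ x, φ x = g x)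
    (r : L2 n) (w : Fin n → L2 n) :
    ∫ x, g x • fourierState r w x = (pair r (𝓕 φ), fun j => pair (w j) (𝓕 φ)) := by
  have hae : ∀ᵐ x, g x • fourierState r w x
      = (φ x * (𝓕 (toC r) : CL2 n) x, fun j => φ x * (𝓕 (toC (w j)) : CL2 n) x) := by
    filter_upwards [coeFn_assemble (𝓕 (toC r)) fun j => 𝓕 (toC (w j))] with x hx
    rw [fourierState, hx, hφ]
    ext j <;> simp
  rw [integral_congr_ae hae, integral_pair (integrable_schwartz_mul φ _)
    (Integrable.of_eval fun j => integrable_schwartz_mul φ _), pair_fourier]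
  congr 1
  funext j
  rw [eval_integral fun j => integrable_schwartz_mul φ _, pair_fourier]

lemma integral_smul_symbol_fourierState (α β γ : ℝ) {g : Sp n → ℝ} {φ : 𝓢(Sp n, ℂ)}
    (hφ : ∀ x, φ x = g x) (r : L2 n) (w : Fin n → L2 n) :
    ∫ x, g x • symbol α β γ ((2 * Real.pi) • x) (fourierState r w x)
      = (γ * (∑ k, pair (w k) (pd k (𝓕 φ))), fun j =>
          α * (∑ k, pair (w j) (pd k (pd k (𝓕 φ)))) + β * (∑ k, pair (w k) (pd k (pd j (𝓕 φ))))
            + γ * pair r (pd j (𝓕 φ))) := by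
  set R : CL2 n := 𝓕 (toC r)
  set W : Fin n → CL2 n := fun j => 𝓕 (toC (w j))
  have hint := integrable_schwartz_mul (n := n)
  have hsum (ψ : Fin n → 𝓢(Sp n, ℂ)) (f : Fin n → CL2 n) :
      Integrable (fun x => ∑ k, ψ k x * f k x) volume :=
    integrable_finsetSum _ fun k _ => hint (ψ k) (f k)
  let D (x : Sp n) : ℂ := γ * ∑ k, mulCoord k φ x * W k x
  let F (j : Fin n) (x : Sp n) : ℂ := α * ∑ k, mulCoord k (mulCoord k φ) x * W j x
  let G (j : Fin n) (x : Sp n) : ℂ := β * ∑ k, mulCoord k (mulCoord j φ) x * W k x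
  let H (j : Fin n) (x : Sp n) : ℂ := γ * (mulCoord j φ x * R x)
  have hD : Integrable D := (hsum _ _).const_mul _
  have hF (j : Fin n) : Integrable (F j) := (hsum _ _).const_mul _
  have hG (j : Fin n) : Integrable (G j) := (hsum _ _).const_mul _
  have hH (j : Fin n) : Integrable (H j) := (hint _ _).const_mul _
  have hae : ∀ᵐ x, g x • symbol α β γ ((2 * Real.pi) • x) (fourierState r w x)
      = (D x, fun j => F j x + G j x + H j x) := by
    filter_upwards [coeFn_assemble R W] with x hx
    rw [← map_smul, fourierState, hx, symbol_two_pi_smul]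
    simp only [D, F, G, H, mulCoord_apply, hφ, Prod.smul_fst, Prod.smul_snd, Pi.smul_apply,
      Complex.real_smul, mul_assoc]
  have hFG (j : Fin n) : Integrable fun x => F j x + G j x := (hF j).add (hG j)
  have hvel (j : Fin n) : Integrable fun x => F j x + G j x + H j x := (hFG j).add (hH j)
  rw [integral_congr_ae hae, integral_pair hD (.of_eval hvel)]
  simp only [pd_fourier, pair_fourier]
  refine Prod.ext ?_ (funext fun j => (eval_integral hvel j).trans ?_)
  · simp only [D, integral_const_mul, integral_finsetSum _ fun _ _ => hint _ _, W]
  · rw [integral_add (hFG j) (hH j), integral_add (hF j) (hG j)]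
    simp only [F, G, H, integral_const_mul, integral_finsetSum _ fun _ _ => hint _ _, R, W]

lemma IsSolution.hasDerivAt_integral_smul_fourierState {α β γ : ℝ} {ρ₀ : Sp n → ℝ}
    {v₀ : Fin n → Sp n → ℝ} {ρ : ℝ → L2 n} {v : ℝ → Fin n → L2 n}
    (h : IsSolution α β γ ρ₀ v₀ ρ v) {t : ℝ} (ht : 0 < t) {g : Sp n → ℝ} (hg : ContDiff ℝ ∞ g)
    (hg' : HasCompactSupport g) :
    HasDerivAt (fun s => ∫ x, g x • fourierState (ρ s) (v s) x)
      (∫ x, g x • symbol α β γ ((2 * Real.pi) • x) (fourierState (ρ t) (v t) x)) t := by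
  let φ : 𝓢(Sp n, ℂ) := (hg'.comp_left Complex.ofReal_zero).toSchwartzMap
    (Complex.ofRealCLM.contDiff.comp hg)
  have hφ (x : Sp n) : φ x = g x := rfl
  simp only [integral_smul_fourierState hφ, integral_smul_symbol_fourierState α β γ hφ]
  exact (h.continuity_equation t ht (𝓕 φ)).prodMk
    (hasDerivAt_pi.2 fun j => h.momentum_equation t ht j (𝓕 φ))

lemma quasiMeasurePreserving_const_smul {c : ℝ} (hc : c ≠ 0) :
    Measure.QuasiMeasurePreserving (fun ξ : Sp n => c • ξ) volume volume := by
  refine ⟨measurable_const_smul c, ?_⟩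
  rw [Measure.map_addHaar_smul _ hc]
  exact Measure.smul_absolutelyContinuous

lemma ae_fourierState_rescaled (r : L2 n) (w : Fin n → L2 n) :
    ∀ᵐ ξ : Sp n, fourierState r w ((2 * Real.pi)⁻¹ • ξ)
      = (fourierL2 r ξ, fun j => fourierL2 (w j) ξ) :=
  (quasiMeasurePreserving_const_smul (by positivity)).ae
    (coeFn_assemble (𝓕 (toC r)) fun j => 𝓕 (toC (w j)))

/-- `(ρ, v)` solves the Fourier-transformed system at the frequency `ξ`. -/
structure IsModeSolution (α β γ : ℝ) (ξ : Sp n) (ρ : ℝ → ℂ) (v : ℝ → Fin n → ℂ) : Prop where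
  density : ∀ s, HasDerivAt ρ (-(Complex.I * γ * freqDot ξ (v s))) s
  velocity : ∀ s j, HasDerivAt (fun s => v s j)
    (-(α * (‖ξ‖ : ℂ) ^ 2 * v s j) - β * ξ j * freqDot ξ (v s) - Complex.I * γ * ξ j * ρ s) s

lemma isModeSolution_exp_symbol (α β γ : ℝ) (ξ : Sp n) (y : ModeState n) :
    IsModeSolution α β γ ξ (fun s => (NormedSpace.exp (s • symbol α β γ ξ) y).1)
      (fun s => (NormedSpace.exp (s • symbol α β γ ξ) y).2) := by
  have hderiv (s : ℝ) : HasDerivAt (fun s : ℝ => NormedSpace.exp (s • symbol α β γ ξ) y)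
      (symbol α β γ ξ (NormedSpace.exp (s • symbol α β γ ξ) y)) s := by
    simpa using (hasDerivAt_exp_smul_const' (𝕂 := ℝ) (symbol α β γ ξ) s).clm_apply
      (hasDerivAt_const s y)
  exact ⟨fun s => (hderiv s).fst, fun s => hasDerivAt_pi.1 (hderiv s).snd⟩

theorem IsSolution.ae_exists_isModeSolution {α β γ : ℝ} {ρ₀ : Sp n → ℝ} {v₀ : Fin n → Sp n → ℝ}
    {ρ : ℝ → L2 n} {v : ℝ → Fin n → L2 n} (h : IsSolution α β γ ρ₀ v₀ ρ v) {t : ℝ} (ht : 0 ≤ t) :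
    ∀ᵐ ξ : Sp n, ∃ (a : ℝ → ℂ) (b : ℝ → Fin n → ℂ), IsModeSolution α β γ ξ a b ∧
      a 0 = fourierL2 (ρ 0) ξ ∧ (∀ j, b 0 j = fourierL2 (v 0 j) ξ) ∧
      ∀ j, b t j = fourierL2 (v t j) ξ := by
  have hcont : ContinuousOn (fun s => fourierState (ρ s) (v s)) (Ici 0) := continuousOn_assemble
    (continuous_fourier_toC.comp_continuousOn h.continuousOn_density)
    fun j => continuous_fourier_toC.comp_continuousOn (h.continuousOn_velocity j)
  have hexp := ae_eq_exp_of_weak ((continuous_symbol α β γ).comp (continuous_const_smul _)) hcont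
    (fun _ hs _ hg hg' => h.hasDerivAt_integral_smul_fourierState hs hg hg') ht
  filter_upwards [(quasiMeasurePreserving_const_smul (c := (2 * Real.pi)⁻¹) (by positivity)).ae
    hexp, ae_fourierState_rescaled (ρ 0) (v 0), ae_fourierState_rescaled (ρ t) (v t)]
    with ξ hξ h0 ht
  rw [Function.comp_apply, smul_inv_smul₀ (by positivity), h0, ht] at hξ
  refine ⟨_, _, isModeSolution_exp_symbol α β γ ξ (fourierL2 (ρ 0) ξ, fun j => fourierL2 (v 0 j) ξ),
    ?_, fun j => ?_, fun j => ?_⟩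
  · rw [exp_zero_smul_apply]
  · rw [exp_zero_smul_apply]
  · rw [← hξ]

end FourierSide

lemma eq_exp_mul_of_hasDerivAt {a : ℝ → ℂ} {c : ℝ} (h : ∀ s, HasDerivAt a (c * a s) s) (t : ℝ) :
    a t = Real.exp (c * t) * a 0 := by
  have hexp (s : ℝ) : HasDerivAt (fun s : ℝ => Real.exp (-(c * s))) (Real.exp (-(c * s)) * -c) s :=
    by simpa using ((hasDerivAt_id s).const_mul c).neg.exp
  have hconst (s : ℝ) : HasDerivAt (fun s : ℝ => (Real.exp (-(c * s)) : ℂ) * a s) 0 s :=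
    ((hexp s).ofReal_comp.mul (h s)).congr_deriv (by push_cast; ring)
  have h0 := is_const_of_deriv_eq_zero (fun s => (hconst s).differentiableAt)
    (fun s => (hconst s).deriv) t 0
  simp only [mul_zero, neg_zero, Real.exp_zero, Complex.ofReal_one, one_mul] at h0
  rw [← h0, ← mul_assoc, ← Complex.ofReal_mul, ← Real.exp_add, add_neg_cancel, Real.exp_zero,
    Complex.ofReal_one, one_mul]

lemma eq_cos_add_sin_of_hasDerivAt {a b : ℝ → ℂ} {ω : ℝ} (ha : ∀ s, HasDerivAt a (ω * b s) s)
    (hb : ∀ s, HasDerivAt b (-(ω * a s)) s) (t : ℝ) :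
    a t = Real.cos (ω * t) * a 0 + Real.sin (ω * t) * b 0 := by
  have hlin (s : ℝ) : HasDerivAt (fun s : ℝ => ω * s) ω s := by
    simpa using (hasDerivAt_id s).const_mul ω
  have hcos (s : ℝ) := (hlin s).cos.ofReal_comp
  have hsin (s : ℝ) := (hlin s).sin.ofReal_comp
  have hfst (s : ℝ) : HasDerivAt (fun s : ℝ => (Real.cos (ω * s) : ℂ) * a s
      - Real.sin (ω * s) * b s) 0 s :=
    (((hcos s).mul (ha s)).sub ((hsin s).mul (hb s))).congr_deriv (by push_cast; ring)
  have hsnd (s : ℝ) : HasDerivAt (fun s : ℝ => (Real.sin (ω * s) : ℂ) * a s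
      + Real.cos (ω * s) * b s) 0 s :=
    (((hsin s).mul (ha s)).add ((hcos s).mul (hb s))).congr_deriv (by push_cast; ring)
  have e₁ := is_const_of_deriv_eq_zero (fun s => (hfst s).differentiableAt)
    (fun s => (hfst s).deriv) t 0
  have e₂ := is_const_of_deriv_eq_zero (fun s => (hsnd s).differentiableAt)
    (fun s => (hsnd s).deriv) t 0
  simp only [mul_zero, Real.cos_zero, Real.sin_zero, Complex.ofReal_one, one_mul,
    Complex.ofReal_zero, zero_mul, sub_zero, zero_add] at e₁ e₂
  have hpyth : (Real.cos (ω * t) : ℂ) ^ 2 + (Real.sin (ω * t) : ℂ) ^ 2 = 1 := by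
    exact_mod_cast Real.cos_sq_add_sin_sq (ω * t)
  rw [← e₁, ← e₂]
  linear_combination -a t * hpyth

lemma le_exp_mul_of_hasDerivAt_le {f f' : ℝ → ℝ} {c : ℝ} (hf : ∀ s, HasDerivAt f (f' s) s)
    (hle : ∀ s, f' s ≤ -c * f s) {t : ℝ} (ht : 0 ≤ t) : f t ≤ Real.exp (-c * t) * f 0 := by
  have hexp (s : ℝ) : HasDerivAt (fun s : ℝ => Real.exp (c * s)) (Real.exp (c * s) * c) s := by
    simpa using ((hasDerivAt_id s).const_mul c).exp
  have hanti : Antitone fun s => Real.exp (c * s) * f s :=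
    antitone_of_hasDerivAt_nonpos (fun s => (hexp s).mul (hf s)) fun s => by
      have := mul_le_mul_of_nonneg_left (hle s) (Real.exp_nonneg (c * s))
      simp only [Pi.zero_apply]
      linarith
  calc f t = Real.exp (-c * t) * (Real.exp (c * t) * f t) := by
        rw [← mul_assoc, ← Real.exp_add, neg_mul, neg_add_cancel, Real.exp_zero, one_mul]
    _ ≤ Real.exp (-c * t) * f 0 := by
        gcongr
        simpa using hanti ht

section Longitudinal

variable {ν γ r S t : ℝ} {a ρ : ℝ → ℂ} {p Q : ℂ}

/-- The system satisfied at frequencies of modulus `r` by the density `ρ` and the component `a` of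
the velocity along the frequency. -/
structure IsLongitudinalPair (ν γ r : ℝ) (a ρ : ℝ → ℂ) : Prop where
  velocity : ∀ s, HasDerivAt a (-(ν * r ^ 2 * a s) - Complex.I * γ * r * ρ s) s
  density : ∀ s, HasDerivAt ρ (-(Complex.I * γ * r * a s)) s

/-- The leading term at low frequencies of the longitudinal velocity with initial velocity `p` and
initial density `Q`. -/
def dampedWave (ν γ r t : ℝ) (p Q : ℂ) : ℂ :=
  Real.exp (-(ν / 2 * r ^ 2 * t)) *
    (Real.cos (γ * t * r) * p - Complex.I * Real.sin (γ * t * r) * Q)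

/-- Bounds, by the size `S` of the data, on the initial longitudinal velocity `a₀` and density `ρ₀`
at a frequency of modulus `r` and on their deviations from `p` and `Q`, their values at frequency
zero. -/
structure IsNearMean (r S : ℝ) (a₀ ρ₀ p Q : ℂ) : Prop where
  norm_velocity_le : ‖a₀‖ ≤ S
  norm_velocity_mean_le : ‖p‖ ≤ S
  norm_density_mean_le : ‖Q‖ ≤ S
  norm_velocity_sub_le : ‖a₀ - p‖ ≤ r * S
  norm_density_sub_le : ‖ρ₀ - Q‖ ≤ r * S

lemma exists_dispersion (hν : 0 < ν) (hγ : 0 < γ) (hr : 0 < r) (hlow : ν * r ≤ γ) :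
    ∃ ω : ℝ, γ * r / 2 ≤ ω ∧ ω ^ 2 = (γ * r) ^ 2 - (ν / 2 * r ^ 2) ^ 2 ∧
      |ω - γ * r| ≤ ν ^ 2 / (4 * γ) * r ^ 3 := by
  have hle : (ν * r ^ 2) ^ 2 ≤ (γ * r) ^ 2 := by
    gcongr ?_ ^ 2
    calc ν * r ^ 2 = ν * r * r := by ring
      _ ≤ γ * r := by gcongr
  have hpos : 0 ≤ (γ * r) ^ 2 - (ν / 2 * r ^ 2) ^ 2 := by nlinarith
  have hsq := Real.sq_sqrt hpos
  set ω := √((γ * r) ^ 2 - (ν / 2 * r ^ 2) ^ 2)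
  have hω : 0 ≤ ω := Real.sqrt_nonneg _
  have hγr : 0 < γ * r := by positivity
  refine ⟨ω, (abs_le_of_sq_le_sq' (by nlinarith) hω).2, hsq, ?_⟩
  have hmul : |ω - γ * r| * (ω + γ * r) = (ν / 2 * r ^ 2) ^ 2 := by
    calc |ω - γ * r| * (ω + γ * r) = |(ω - γ * r) * (ω + γ * r)| := by
          rw [abs_mul, abs_of_pos (by positivity : 0 < ω + γ * r)]
      _ = |-(ν / 2 * r ^ 2) ^ 2| := congrArg abs (by linear_combination hsq)
      _ = (ν / 2 * r ^ 2) ^ 2 := by rw [abs_neg, abs_of_nonneg (sq_nonneg _)]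
  calc |ω - γ * r| ≤ (ν / 2 * r ^ 2) ^ 2 / (γ * r) := by
        rw [le_div_iff₀ hγr, ← hmul]
        gcongr
        linarith
    _ = ν ^ 2 / (4 * γ) * r ^ 3 := by
        field_simp
        ring

lemma IsLongitudinalPair.eq_of_dispersion (h : IsLongitudinalPair ν γ r a ρ) {ω : ℝ} (hω : ω ≠ 0)
    (hω2 : ω ^ 2 = (γ * r) ^ 2 - (ν / 2 * r ^ 2) ^ 2) (t : ℝ) :
    a t = Real.exp (-(ν / 2 * r ^ 2 * t)) * (Real.cos (ω * t) * a 0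
      - Real.sin (ω * t) * ((ν / 2 * r ^ 2 * a 0 + Complex.I * γ * r * ρ 0) / ω)) := by
  have hωc : (ω : ℂ) ≠ 0 := by exact_mod_cast hω
  have hω2c : (ω : ℂ) ^ 2 = (γ * r) ^ 2 - (ν / 2 * r ^ 2) ^ 2 := by exact_mod_cast hω2
  have hexp (s : ℝ) : HasDerivAt (fun s : ℝ => (Real.exp (ν / 2 * r ^ 2 * s) : ℂ))
      (Real.exp (ν / 2 * r ^ 2 * s) * (ν / 2 * r ^ 2)) s := by
    exact_mod_cast (by simpa using ((hasDerivAt_id s).const_mul (ν / 2 * r ^ 2)).exp :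
      HasDerivAt (fun s => Real.exp (ν / 2 * r ^ 2 * s)) _ s).ofReal_comp
  have hosc := eq_cos_add_sin_of_hasDerivAt (ω := ω)
    (a := fun s => (Real.exp (ν / 2 * r ^ 2 * s) : ℂ) * a s)
    (b := fun s => (Real.exp (ν / 2 * r ^ 2 * s) : ℂ) *
      (-(ν / 2 * r ^ 2 * a s) - Complex.I * γ * r * ρ s) / ω)
    (fun s => ((hexp s).mul (h.velocity s)).congr_deriv (by field_simp; ring))
    (fun s => (((hexp s).mul (((h.velocity s).const_mul (ν / 2 * r ^ 2 : ℂ)).fun_neg.fun_sub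
      ((h.density s).const_mul (Complex.I * γ * r)))).div_const _).congr_deriv (by
        rw [div_eq_iff hωc]
        linear_combination (Real.exp (ν / 2 * r ^ 2 * s) : ℂ) * a s *
          (hω2c + (γ * r) ^ 2 * Complex.I_sq))) t
  simp only [mul_zero, Real.exp_zero, Complex.ofReal_one, one_mul] at hosc
  have hinv : (Real.exp (-(ν / 2 * r ^ 2 * t)) : ℂ) * Real.exp (ν / 2 * r ^ 2 * t) = 1 := by
    rw [← Complex.ofReal_mul, ← Real.exp_add, neg_add_cancel, Real.exp_zero, Complex.ofReal_one]
  linear_combination (-a t) * hinv + (Real.exp (-(ν / 2 * r ^ 2 * t)) : ℂ) * hosc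

lemma abs_div_sub_one_le_of_dispersion (hν : 0 < ν) (hγ : 0 < γ) (hr : 0 < r) (hlow : ν * r ≤ γ)
    {ω : ℝ} (hω : γ * r / 2 ≤ ω) (hsub : |ω - γ * r| ≤ ν ^ 2 / (4 * γ) * r ^ 3) :
    |γ * r / ω - 1| ≤ ν / (2 * γ) * r := by
  have hω0 : 0 < ω := lt_of_lt_of_le (by positivity) hω
  calc |γ * r / ω - 1| = |γ * r - ω| / ω := by rw [div_sub_one hω0.ne', abs_div, abs_of_pos hω0]
    _ = |ω - γ * r| / ω := by rw [abs_sub_comm]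
    _ ≤ ν ^ 2 / (4 * γ) * r ^ 3 / (γ * r / 2) := by gcongr
    _ = ν / (2 * γ ^ 2) * r * (ν * r) := by field_simp; ring
    _ ≤ ν / (2 * γ ^ 2) * r * γ := by gcongr
    _ = ν / (2 * γ) * r := by field_simp

lemma norm_ofReal_mul_sub_ofReal_mul_le (c d : ℝ) (z w : ℂ) :
    ‖c * z - d * w‖ ≤ |c| * ‖z - w‖ + |c - d| * ‖w‖ := by
  calc ‖c * z - d * w‖ = ‖c * (z - w) + (c - d : ℝ) * w‖ := by
        congr 1
        push_cast
        ring
    _ ≤ |c| * ‖z - w‖ + |c - d| * ‖w‖ :=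
        (norm_add_le _ _).trans_eq (by simp only [norm_mul, Complex.norm_real, Real.norm_eq_abs])

lemma norm_cos_mul_sub_cos_mul_le (x y : ℝ) (z w : ℂ) :
    ‖Real.cos x * z - Real.cos y * w‖ ≤ ‖z - w‖ + |x - y| * ‖w‖ := by
  refine (norm_ofReal_mul_sub_ofReal_mul_le _ _ z w).trans ?_
  gcongr ?_ + ?_ * _
  exacts [mul_le_of_le_one_left (norm_nonneg _) (Real.abs_cos_le_one x),
    Real.abs_cos_sub_cos_le x y]

lemma norm_sin_mul_sub_sin_mul_le (x y : ℝ) (z w : ℂ) :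
    ‖Real.sin x * z - Real.sin y * w‖ ≤ ‖z - w‖ + |x - y| * ‖w‖ := by
  have h := norm_cos_mul_sub_cos_mul_le (Real.pi / 2 - x) (Real.pi / 2 - y) z w
  rwa [Real.cos_pi_div_two_sub, Real.cos_pi_div_two_sub, sub_sub_sub_cancel_left, abs_sub_comm] at h

lemma norm_sin_mul_damping_mul_le (hν : 0 < ν) (hγ : 0 < γ) (hr : 0 < r) {ω : ℝ}
    (hω : γ * r / 2 ≤ ω) (θ : ℝ) {z : ℂ} (hz : ‖z‖ ≤ S) :
    ‖Real.sin θ * ((ν / 2 * r ^ 2 / ω : ℝ) * z)‖ ≤ ν / γ * r * S := by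
  have hω0 : 0 < ω := lt_of_lt_of_le (by positivity) hω
  calc ‖Real.sin θ * ((ν / 2 * r ^ 2 / ω : ℝ) * z)‖
      = |Real.sin θ| * (ν / 2 * r ^ 2 / ω * ‖z‖) := by
        rw [norm_mul, norm_mul, Complex.norm_real, Complex.norm_real, Real.norm_eq_abs,
          Real.norm_of_nonneg (by positivity)]
    _ ≤ 1 * (ν / 2 * r ^ 2 / (γ * r / 2) * S) := by
        gcongr
        exact Real.abs_sin_le_one θ
    _ = ν / γ * r * S := by field_simp

lemma norm_sin_mul_div_mul_sub_le (hν : 0 < ν) (hγ : 0 < γ) (hr : 0 < r) (hlow : ν * r ≤ γ)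
    {ω : ℝ} (hω : γ * r / 2 ≤ ω) (hsub : |ω - γ * r| ≤ ν ^ 2 / (4 * γ) * r ^ 3) (θ φ : ℝ) {z : ℂ}
    (hz : ‖z - Q‖ ≤ r * S) (hQ : ‖Q‖ ≤ S) :
    ‖Real.sin θ * ((γ * r / ω : ℝ) * z) - Real.sin φ * Q‖
      ≤ 2 * (r * S) + ν / (2 * γ) * r * S + |θ - φ| * S := by
  have hω0 : 0 < ω := lt_of_lt_of_le (by positivity) hω
  have hratio : |γ * r / ω| ≤ 2 := by
    rw [abs_of_pos (by positivity), div_le_iff₀ hω0]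
    linarith
  have hdens : ‖((γ * r / ω : ℝ) : ℂ) * z - (1 : ℝ) * Q‖ ≤ 2 * (r * S) + ν / (2 * γ) * r * S := by
    refine (norm_ofReal_mul_sub_ofReal_mul_le _ _ _ _).trans ?_
    gcongr
    exact abs_div_sub_one_le_of_dispersion hν hγ hr hlow hω hsub
  rw [Complex.ofReal_one, one_mul] at hdens
  exact (norm_sin_mul_sub_sin_mul_le _ _ _ _).trans (by gcongr)

lemma norm_oscillation_sub_le (hν : 0 < ν) (hγ : 0 < γ) (hr : 0 < r) (hlow : ν * r ≤ γ)
    (ht : 0 ≤ t) {ω : ℝ} (hω : γ * r / 2 ≤ ω) (hsub : |ω - γ * r| ≤ ν ^ 2 / (4 * γ) * r ^ 3)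
    {a₀ ρ₀ : ℂ} (hm : IsNearMean r S a₀ ρ₀ p Q) :
    ‖Real.cos (ω * t) * a₀ - Real.sin (ω * t) * ((ν / 2 * r ^ 2 * a₀ + Complex.I * γ * r * ρ₀) / ω)
        - (Real.cos (γ * t * r) * p - Complex.I * Real.sin (γ * t * r) * Q)‖
      ≤ (3 + 3 * ν / (2 * γ) + ν ^ 2 / (2 * γ)) * (r * S * (1 + r ^ 2 * t)) := by
  have hS : 0 ≤ S := (norm_nonneg _).trans hm.norm_velocity_le
  have hphase : |ω * t - γ * t * r| ≤ ν ^ 2 / (4 * γ) * (r * (r ^ 2 * t)) := by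
    calc |ω * t - γ * t * r| = |ω - γ * r| * t := by
          rw [← abs_of_nonneg ht, ← abs_mul, abs_of_nonneg ht]
          ring_nf
      _ ≤ ν ^ 2 / (4 * γ) * r ^ 3 * t := by gcongr
      _ = _ := by ring
  have hphaseS := mul_le_mul_of_nonneg_right hphase hS
  have hcos : ‖Real.cos (ω * t) * a₀ - Real.cos (γ * t * r) * p‖
      ≤ r * S + |ω * t - γ * t * r| * S :=
    (norm_cos_mul_sub_cos_mul_le _ _ _ _).trans
      (add_le_add hm.norm_velocity_sub_le (by gcongr; exact hm.norm_velocity_mean_le))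
  have hdamp := norm_sin_mul_damping_mul_le hν hγ hr hω (ω * t) hm.norm_velocity_le
  have hsin := norm_sin_mul_div_mul_sub_le hν hγ hr hlow hω hsub (ω * t) (γ * t * r)
    hm.norm_density_sub_le hm.norm_density_mean_le
  set velErr : ℂ := Real.cos (ω * t) * a₀ - Real.cos (γ * t * r) * p
  set dampErr : ℂ := Real.sin (ω * t) * ((ν / 2 * r ^ 2 / ω : ℝ) * a₀)
  set densErr : ℂ := Real.sin (ω * t) * ((γ * r / ω : ℝ) * ρ₀) - Real.sin (γ * t * r) * Q
  calc _ = ‖velErr - dampErr - Complex.I * densErr‖ := by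
        congr 1
        simp only [velErr, dampErr, densErr]
        push_cast
        ring
    _ ≤ ‖velErr‖ + ‖dampErr‖ + ‖densErr‖ := by
        refine (norm_sub_le _ _).trans (add_le_add (norm_sub_le _ _) ?_)
        rw [norm_mul, Complex.norm_I, one_mul]
    _ ≤ r * S + ν ^ 2 / (4 * γ) * (r * (r ^ 2 * t)) * S + ν / γ * r * S + (2 * (r * S)
          + ν / (2 * γ) * r * S + ν ^ 2 / (4 * γ) * (r * (r ^ 2 * t)) * S) := by linarith
    _ = (3 + 3 * ν / (2 * γ)) * (r * S * 1) + ν ^ 2 / (2 * γ) * (r * S * (r ^ 2 * t)) := by ring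
    _ ≤ (3 + 3 * ν / (2 * γ)) * (r * S * (1 + r ^ 2 * t))
          + ν ^ 2 / (2 * γ) * (r * S * (1 + r ^ 2 * t)) := by
        gcongr
        exacts [le_add_of_nonneg_right (by positivity), le_add_of_nonneg_left zero_le_one]
    _ = _ := by ring

lemma IsLongitudinalPair.norm_sub_dampedWave_le (h : IsLongitudinalPair ν γ r a ρ) (hν : 0 < ν)
    (hγ : 0 < γ) (hr : 0 < r) (hlow : ν * r ≤ γ) (ht : 0 ≤ t)
    (hm : IsNearMean r S (a 0) (ρ 0) p Q) :
    ‖a t - dampedWave ν γ r t p Q‖ ≤ (3 + 3 * ν / (2 * γ) + ν ^ 2 / (2 * γ)) *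
      (r * S * ((1 + r ^ 2 * t) * Real.exp (-(ν / 2 * r ^ 2 * t)))) := by
  obtain ⟨ω, hω, hω2, hsub⟩ := exists_dispersion hν hγ hr hlow
  have hω0 : 0 < ω := lt_of_lt_of_le (by positivity) hω
  rw [h.eq_of_dispersion hω0.ne' hω2, dampedWave, ← mul_sub, norm_mul, Complex.norm_real,
    Real.norm_of_nonneg (Real.exp_nonneg _)]
  have hosc := mul_le_mul_of_nonneg_left (norm_oscillation_sub_le hν hγ hr hlow ht hω hsub hm)
    (Real.exp_nonneg (-(ν / 2 * r ^ 2 * t)))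
  linarith

/-- At high frequencies the energy `‖a‖² + ‖ρ‖²` dissipates only through `a`. The interaction term
transfers the dissipation to `ρ`. -/
def lyapunov (ν γ r : ℝ) (a ρ : ℂ) : ℝ :=
  ‖a‖ ^ 2 + ‖ρ‖ ^ 2 + γ / (2 * ν * r) * inner ℝ (Complex.I * ρ) a

lemma abs_inner_I_mul_le (a ρ : ℂ) : |inner ℝ (Complex.I * ρ) a| ≤ ‖ρ‖ * ‖a‖ := by
  simpa using abs_real_inner_le_norm (Complex.I * ρ) a

lemma abs_lyapunov_sub_le (hν : 0 < ν) (hγ : 0 < γ) (hhigh : γ ≤ ν * r) (a ρ : ℂ) :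
    |lyapunov ν γ r a ρ - (‖a‖ ^ 2 + ‖ρ‖ ^ 2)| ≤ (‖a‖ ^ 2 + ‖ρ‖ ^ 2) / 4 := by
  have hr : 0 < r := (mul_pos_iff_of_pos_left hν).1 (hγ.trans_le hhigh)
  have hcoef : γ / (2 * ν * r) ≤ 1 / 2 := by
    rw [div_le_div_iff₀ (by positivity) two_pos]
    linarith
  rw [lyapunov, add_sub_cancel_left, abs_mul, abs_of_nonneg (by positivity)]
  calc γ / (2 * ν * r) * |inner ℝ (Complex.I * ρ) a| ≤ 1 / 2 * (‖ρ‖ * ‖a‖) := by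
        gcongr
        exact abs_inner_I_mul_le a ρ
    _ ≤ (‖a‖ ^ 2 + ‖ρ‖ ^ 2) / 4 := by linarith [two_mul_le_add_sq ‖a‖ ‖ρ‖]

lemma IsLongitudinalPair.hasDerivAt_lyapunov (h : IsLongitudinalPair ν γ r a ρ) (s : ℝ) :
    HasDerivAt (fun s => lyapunov ν γ r (a s) (ρ s))
      (-(2 * ν * r ^ 2 * ‖a s‖ ^ 2) + γ / (2 * ν * r) * (γ * r * (‖a s‖ ^ 2 - ‖ρ s‖ ^ 2)
        - ν * r ^ 2 * inner ℝ (Complex.I * ρ s) (a s))) s := by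
  refine (((h.velocity s).norm_sq.add (h.density s).norm_sq).add
    ((((h.density s).const_mul Complex.I).inner ℝ (h.velocity s)).const_mul _)).congr_deriv ?_
  simp only [Complex.inner, Complex.sq_norm, Complex.normSq_apply, map_mul, Complex.conj_I,
    Complex.mul_re, Complex.mul_im, Complex.sub_re, Complex.sub_im, Complex.neg_re, Complex.neg_im,
    Complex.conj_re, Complex.conj_im, Complex.I_re, Complex.I_im, Complex.ofReal_re,
    Complex.ofReal_im, ← Complex.ofReal_pow, map_neg]
  ring

lemma lyapunov_dissipation_le (hν : 0 < ν) (hγ : 0 < γ) (hhigh : γ ≤ ν * r) (a ρ : ℂ) :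
    -(2 * ν * r ^ 2 * ‖a‖ ^ 2) + γ / (2 * ν * r) * (γ * r * (‖a‖ ^ 2 - ‖ρ‖ ^ 2)
        - ν * r ^ 2 * inner ℝ (Complex.I * ρ) a)
      ≤ -(γ ^ 2 / (5 * ν)) * lyapunov ν γ r a ρ := by
  have hr : 0 < r := (mul_pos_iff_of_pos_left hν).1 (hγ.trans_le hhigh)
  have hγν : γ ^ 2 / ν ≤ ν * r ^ 2 := by
    rw [div_le_iff₀ hν]
    calc γ ^ 2 ≤ (ν * r) ^ 2 := by gcongr
      _ = ν * r ^ 2 * ν := by ring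
  have hvel := mul_le_mul_of_nonneg_right hγν (sq_nonneg ‖a‖)
  have hcross : γ * r * (‖ρ‖ * ‖a‖) ≤ γ ^ 2 / ν * ‖ρ‖ ^ 2 / 2 + ν * r ^ 2 * ‖a‖ ^ 2 / 2 := by
    have := div_nonneg (sq_nonneg (γ * ‖ρ‖ - ν * r * ‖a‖)) (by positivity : 0 ≤ 2 * ν)
    have : (γ * ‖ρ‖ - ν * r * ‖a‖) ^ 2 / (2 * ν) = γ ^ 2 / ν * ‖ρ‖ ^ 2 / 2
        + ν * r ^ 2 * ‖a‖ ^ 2 / 2 - γ * r * (‖ρ‖ * ‖a‖) := by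
      field_simp
      ring
    linarith
  have hint := mul_le_mul_of_nonneg_left (neg_le_of_abs_le (abs_inner_I_mul_le a ρ))
    (by positivity : 0 ≤ γ * r)
  have hlyap := mul_le_mul_of_nonneg_left (le_of_abs_le (abs_lyapunov_sub_le hν hγ hhigh a ρ))
    (by positivity : 0 ≤ γ ^ 2 / ν)
  calc _ = -(2 * (ν * r ^ 2 * ‖a‖ ^ 2)) + γ ^ 2 / ν * ‖a‖ ^ 2 / 2 - γ ^ 2 / ν * ‖ρ‖ ^ 2 / 2
        - γ * r * inner ℝ (Complex.I * ρ) a / 2 := by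
        field_simp
        ring
    _ ≤ -(γ ^ 2 / ν * lyapunov ν γ r a ρ / 5) := by
        linarith [mul_nonneg (div_nonneg (sq_nonneg γ) hν.le) (sq_nonneg ‖a‖)]
    _ = -(γ ^ 2 / (5 * ν)) * lyapunov ν γ r a ρ := by
        field_simp

lemma IsLongitudinalPair.energy_le (h : IsLongitudinalPair ν γ r a ρ) (hν : 0 < ν) (hγ : 0 < γ)
    (hhigh : γ ≤ ν * r) (ht : 0 ≤ t) :
    ‖a t‖ ^ 2 + ‖ρ t‖ ^ 2 ≤
      2 * Real.exp (-(γ ^ 2 / (5 * ν)) * t) * (‖a 0‖ ^ 2 + ‖ρ 0‖ ^ 2) := by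
  have hdecay := le_exp_mul_of_hasDerivAt_le h.hasDerivAt_lyapunov
    (fun s => lyapunov_dissipation_le hν hγ hhigh (a s) (ρ s)) ht
  have hlower := neg_le_of_abs_le (abs_lyapunov_sub_le hν hγ hhigh (a t) (ρ t))
  have hupper : lyapunov ν γ r (a 0) (ρ 0) ≤ 5 / 4 * (‖a 0‖ ^ 2 + ‖ρ 0‖ ^ 2) := by
    linarith [le_of_abs_le (abs_lyapunov_sub_le hν hγ hhigh (a 0) (ρ 0))]
  have hexp := mul_le_mul_of_nonneg_left hupper (Real.exp_nonneg (-(γ ^ 2 / (5 * ν)) * t))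
  have : 0 ≤ Real.exp (-(γ ^ 2 / (5 * ν)) * t) * (‖a 0‖ ^ 2 + ‖ρ 0‖ ^ 2) := by positivity
  linarith

lemma sq_one_add_mul_exp_le {b x : ℝ} (hb : 0 < b) (hx : 0 ≤ x) :
    ((1 + x) * Real.exp (-(b * x))) ^ 2 ≤ (1 + 2 / b) ^ 2 * Real.exp (-(b * x)) := by
  have hsplit : Real.exp (-(b * x)) = Real.exp (-(b * x / 2)) ^ 2 := by
    rw [← Real.exp_nat_mul]
    ring_nf
  have hlin : x * Real.exp (-(b * x / 2)) ≤ 2 / b := by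
    rw [Real.exp_neg, ← div_eq_mul_inv, div_le_iff₀ (Real.exp_pos _)]
    calc x = 2 / b * (b * x / 2) := by field_simp
      _ ≤ 2 / b * Real.exp (b * x / 2) := by
          gcongr
          linarith [Real.add_one_le_exp (b * x / 2)]
  have hone : Real.exp (-(b * x / 2)) ≤ 1 :=
    Real.exp_le_one_iff.2 (neg_nonpos.2 (by positivity))
  calc ((1 + x) * Real.exp (-(b * x))) ^ 2
      = ((1 + x) * Real.exp (-(b * x / 2))) ^ 2 * Real.exp (-(b * x)) := by
        rw [hsplit]
        ring
    _ ≤ (1 + 2 / b) ^ 2 * Real.exp (-(b * x)) := by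
        gcongr
        linarith

lemma norm_dampedWave_le (ν γ r t : ℝ) (hp : ‖p‖ ≤ S) (hQ : ‖Q‖ ≤ S) :
    ‖dampedWave ν γ r t p Q‖ ≤ 2 * S * Real.exp (-(ν / 2 * r ^ 2 * t)) := by
  have htrig {c : ℝ} {z : ℂ} (hc : |c| ≤ 1) (hz : ‖z‖ ≤ S) : ‖c * z‖ ≤ S := by
    rw [norm_mul, Complex.norm_real]
    exact (mul_le_of_le_one_left (norm_nonneg z) hc).trans hz
  rw [dampedWave, norm_mul, Complex.norm_real, Real.norm_of_nonneg (Real.exp_nonneg _), mul_comm,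
    two_mul, mul_assoc Complex.I]
  gcongr
  refine (norm_sub_le _ _).trans (add_le_add (htrig (Real.abs_cos_le_one _) hp) ?_)
  rw [norm_mul, Complex.norm_I, one_mul]
  exact htrig (Real.abs_sin_le_one _) hQ

lemma IsLongitudinalPair.sq_norm_sub_dampedWave_le_of_low (h : IsLongitudinalPair ν γ r a ρ)
    (hν : 0 < ν) (hγ : 0 < γ) (hr : 0 < r) (hlow : ν * r ≤ γ) (ht : 0 ≤ t)
    (hm : IsNearMean r S (a 0) (ρ 0) p Q) :
    ‖a t - dampedWave ν γ r t p Q‖ ^ 2 ≤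
      ((3 + 3 * ν / (2 * γ) + ν ^ 2 / (2 * γ)) * (1 + 2 / (ν / 2))) ^ 2 *
        ((r * S) ^ 2 * Real.exp (-(ν / 2 * r ^ 2 * t))) := by
  have hpoly := sq_one_add_mul_exp_le (half_pos hν) (by positivity : 0 ≤ r ^ 2 * t)
  rw [← mul_assoc] at hpoly
  calc _ ≤ ((3 + 3 * ν / (2 * γ) + ν ^ 2 / (2 * γ)) *
        (r * S * ((1 + r ^ 2 * t) * Real.exp (-(ν / 2 * r ^ 2 * t))))) ^ 2 := by
        gcongr
        exact h.norm_sub_dampedWave_le hν hγ hr hlow ht hm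
    _ = ((3 + 3 * ν / (2 * γ) + ν ^ 2 / (2 * γ)) * (r * S)) ^ 2 *
        ((1 + r ^ 2 * t) * Real.exp (-(ν / 2 * r ^ 2 * t))) ^ 2 := by ring
    _ ≤ ((3 + 3 * ν / (2 * γ) + ν ^ 2 / (2 * γ)) * (r * S)) ^ 2 *
        ((1 + 2 / (ν / 2)) ^ 2 * Real.exp (-(ν / 2 * r ^ 2 * t))) := by gcongr
    _ = _ := by ring

lemma IsLongitudinalPair.sq_norm_sub_dampedWave_le_of_high (h : IsLongitudinalPair ν γ r a ρ)
    (hν : 0 < ν) (hγ : 0 < γ) (hhigh : γ ≤ ν * r) (ht : 0 ≤ t) (hp : ‖p‖ ≤ S) (hQ : ‖Q‖ ≤ S) :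
    ‖a t - dampedWave ν γ r t p Q‖ ^ 2 ≤
      8 * (ν / γ) ^ 2 * ((r * S) ^ 2 * Real.exp (-(ν / 2 * r ^ 2 * t)))
        + 4 * (Real.exp (-(γ ^ 2 / (5 * ν)) * t) * (‖a 0‖ ^ 2 + ‖ρ 0‖ ^ 2)) := by
  have hwave : ‖dampedWave ν γ r t p Q‖ ^ 2 ≤
      4 * (ν / γ) ^ 2 * ((r * S) ^ 2 * Real.exp (-(ν / 2 * r ^ 2 * t))) := by
    have hone : 1 ≤ ν * r / γ := (one_le_div hγ).2 hhigh
    have hexp : Real.exp (-(ν / 2 * r ^ 2 * t)) ≤ 1 :=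
      Real.exp_le_one_iff.2 (neg_nonpos.2 (by positivity))
    calc _ ≤ (2 * S * Real.exp (-(ν / 2 * r ^ 2 * t))) ^ 2 := by
          gcongr
          exact norm_dampedWave_le ν γ r t hp hQ
      _ = 4 * (1 * S) ^ 2 *
          (Real.exp (-(ν / 2 * r ^ 2 * t)) * Real.exp (-(ν / 2 * r ^ 2 * t))) := by ring
      _ ≤ 4 * (ν * r / γ * S) ^ 2 * (Real.exp (-(ν / 2 * r ^ 2 * t)) * 1) := by
          have hS : 0 ≤ S := (norm_nonneg p).trans hp
          gcongr
      _ = _ := by ring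
  have htriangle : ‖a t - dampedWave ν γ r t p Q‖ ^ 2
      ≤ 2 * (‖a t‖ ^ 2 + ‖dampedWave ν γ r t p Q‖ ^ 2) :=
    (by gcongr; exact norm_sub_le _ _ : _ ≤ (‖a t‖ + ‖dampedWave ν γ r t p Q‖) ^ 2).trans
      add_sq_le
  linarith [h.energy_le hν hγ hhigh ht, sq_nonneg ‖ρ t‖]

lemma exists_longitudinal_bound (hν : 0 < ν) (hγ : 0 < γ) :
    ∃ C η : ℝ, 0 < C ∧ 0 < η ∧ ∀ {r S t : ℝ} {a ρ : ℝ → ℂ} {p Q : ℂ},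
      IsLongitudinalPair ν γ r a ρ → 0 < r → 0 ≤ t → IsNearMean r S (a 0) (ρ 0) p Q →
      ‖a t - dampedWave ν γ r t p Q‖ ^ 2 ≤ C * ((r * S) ^ 2 * Real.exp (-(ν / 2 * r ^ 2 * t))
        + Real.exp (-η * t) * (‖a 0‖ ^ 2 + ‖ρ 0‖ ^ 2)) := by
  set K := ((3 + 3 * ν / (2 * γ) + ν ^ 2 / (2 * γ)) * (1 + 2 / (ν / 2))) ^ 2
  refine ⟨max K (max (8 * (ν / γ) ^ 2) 4), γ ^ 2 / (5 * ν), by positivity, by positivity,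
    fun {r S t a ρ p Q} h hr ht hm => ?_⟩
  rw [mul_add]
  rcases le_total (ν * r) γ with hlow | hhigh
  · refine (h.sq_norm_sub_dampedWave_le_of_low hν hγ hr hlow ht hm).trans
      (le_add_of_le_of_nonneg ?_ (by positivity))
    gcongr
    exact le_max_left _ _
  · refine (h.sq_norm_sub_dampedWave_le_of_high hν hγ hhigh ht hm.norm_velocity_mean_le
      hm.norm_density_mean_le).trans (add_le_add ?_ ?_)
    · gcongr
      exact (le_max_left _ _).trans (le_max_right _ _)
    · gcongr
      exact (le_max_right _ _).trans (le_max_right _ _)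

end Longitudinal

section ModeSolution

variable {n : ℕ} {α β γ S t : ℝ} {ξ : Sp n}

/-- The component of `a` along the frequency `ξ`. -/
def longComp (ξ : Sp n) (a : Fin n → ℂ) : ℂ := freqDot ξ a / ‖ξ‖

/-- The component of `a` orthogonal to the frequency `ξ`. -/
def transComp (ξ : Sp n) (a : Fin n → ℂ) (j : Fin n) : ℂ := a j - ξ j / ‖ξ‖ * longComp ξ a

lemma freqDot_const_mul (ξ : Sp n) (c : ℂ) (a : Fin n → ℂ) :
    freqDot ξ (fun k => c * a k) = c * freqDot ξ a := by
  simp only [freqDot, Finset.mul_sum, mul_left_comm]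

lemma longComp_sub (ξ : Sp n) (a b : Fin n → ℂ) :
    longComp ξ (a - b) = longComp ξ a - longComp ξ b := by
  simp [longComp, freqDot, mul_sub, sub_div]

lemma transComp_sub (ξ : Sp n) (a b : Fin n → ℂ) (j : Fin n) :
    transComp ξ (a - b) j = transComp ξ a j - transComp ξ b j := by
  simp only [transComp, longComp_sub, Pi.sub_apply]
  ring

lemma transComp_add_longComp (ξ : Sp n) (a : Fin n → ℂ) (j : Fin n) :
    transComp ξ a j + ξ j / ‖ξ‖ * longComp ξ a = a j :=
  sub_add_cancel _ _

lemma sum_ofReal_coord_sq (ξ : Sp n) : ∑ k, (ξ k : ℂ) ^ 2 = (‖ξ‖ : ℂ) ^ 2 := by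
  exact_mod_cast sum_coord_sq ξ

lemma norm_ofReal_ne_zero (hξ : ξ ≠ 0) : (‖ξ‖ : ℂ) ≠ 0 := by simpa using hξ

lemma freqDot_transComp (hξ : ξ ≠ 0) (a : Fin n → ℂ) : freqDot ξ (transComp ξ a) = 0 := by
  have hne := norm_ofReal_ne_zero hξ
  calc freqDot ξ (transComp ξ a)
      = freqDot ξ a - (∑ k, (ξ k : ℂ) ^ 2) * (longComp ξ a / ‖ξ‖) := by
        rw [freqDot, freqDot, Finset.sum_mul, ← Finset.sum_sub_distrib]
        refine Finset.sum_congr rfl fun k _ => ?_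
        rw [transComp]
        ring
    _ = 0 := by
        rw [sum_ofReal_coord_sq, longComp]
        field_simp
        ring

lemma sum_sq_norm_add_longitudinal (hξ : ξ ≠ 0) {b : Fin n → ℂ} (hb : freqDot ξ b = 0) (z : ℂ) :
    ∑ j, ‖b j + ξ j / ‖ξ‖ * z‖ ^ 2 = ∑ j, ‖b j‖ ^ 2 + ‖z‖ ^ 2 := by
  have hcross : ∑ j, inner ℝ (b j) (ξ j / ‖ξ‖ * z) = 0 := by
    calc ∑ j, inner ℝ (b j) (ξ j / ‖ξ‖ * z) = inner ℝ (freqDot ξ b) ((‖ξ‖⁻¹ : ℝ) * z) := by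
          rw [freqDot, sum_inner]
          refine Finset.sum_congr rfl fun j _ => ?_
          simp only [Complex.inner, map_mul, Complex.conj_ofReal, Complex.ofReal_inv]
          ring_nf
      _ = 0 := by rw [hb, inner_zero_left]
  have hunit : ∑ j, ‖(ξ j / ‖ξ‖ * z : ℂ)‖ ^ 2 = ‖z‖ ^ 2 := by
    have hne := norm_ne_zero_iff.2 hξ
    simp only [norm_mul, norm_div, Complex.norm_real, mul_pow, div_pow, Real.norm_eq_abs, sq_abs,
      abs_norm]
    rw [← Finset.sum_mul, ← Finset.sum_div, sum_coord_sq, div_self (pow_ne_zero 2 hne), one_mul]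
  simp only [norm_add_sq_real, Finset.sum_add_distrib, ← Finset.mul_sum, hcross, hunit, mul_zero,
    add_zero]

lemma sum_sq_norm_eq (hξ : ξ ≠ 0) (a : Fin n → ℂ) :
    ∑ j, ‖a j‖ ^ 2 = ∑ j, ‖transComp ξ a j‖ ^ 2 + ‖longComp ξ a‖ ^ 2 := by
  simp only [← sum_sq_norm_add_longitudinal hξ (freqDot_transComp hξ a), transComp_add_longComp]

lemma sq_norm_longComp_le (hξ : ξ ≠ 0) (a : Fin n → ℂ) :
    ‖longComp ξ a‖ ^ 2 ≤ ∑ j, ‖a j‖ ^ 2 := by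
  rw [sum_sq_norm_eq hξ]
  exact le_add_of_nonneg_left (by positivity)

lemma sum_sq_norm_transComp_le (hξ : ξ ≠ 0) (a : Fin n → ℂ) :
    ∑ j, ‖transComp ξ a j‖ ^ 2 ≤ ∑ j, ‖a j‖ ^ 2 := by
  rw [sum_sq_norm_eq hξ a]
  exact le_add_of_nonneg_right (by positivity)

lemma IsModeSolution.isLongitudinalPair {ρ : ℝ → ℂ} {v : ℝ → Fin n → ℂ}
    (h : IsModeSolution α β γ ξ ρ v) (hξ : ξ ≠ 0) :
    IsLongitudinalPair (α + β) γ ‖ξ‖ (fun s => longComp ξ (v s)) ρ where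
  velocity s := by
    have hne := norm_ofReal_ne_zero hξ
    refine ((HasDerivAt.fun_sum fun k _ =>
      (h.velocity s k).const_mul (ξ k : ℂ)).div_const (‖ξ‖ : ℂ)).congr_deriv ?_
    rw [div_eq_iff hne]
    calc _ = -(α * (‖ξ‖ : ℂ) ^ 2 * freqDot ξ (v s))
          - (∑ k, (ξ k : ℂ) ^ 2) * (β * freqDot ξ (v s) + Complex.I * γ * ρ s) := by
          rw [Finset.sum_mul]
          nth_rw 2 [freqDot]
          rw [Finset.mul_sum, ← Finset.sum_neg_distrib, ← Finset.sum_sub_distrib]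
          exact Finset.sum_congr rfl fun k _ => by ring
      _ = _ := by
          rw [sum_ofReal_coord_sq, longComp]
          push_cast
          field_simp
          ring
  density s := (h.density s).congr_deriv (by
    have hne := norm_ofReal_ne_zero hξ
    rw [longComp]
    field_simp)

lemma IsModeSolution.transComp_eq {ρ : ℝ → ℂ} {v : ℝ → Fin n → ℂ}
    (h : IsModeSolution α β γ ξ ρ v) (hξ : ξ ≠ 0) (t : ℝ) (j : Fin n) :
    transComp ξ (v t) j = Real.exp (-(α * ‖ξ‖ ^ 2) * t) * transComp ξ (v 0) j := by
  have hne := norm_ofReal_ne_zero hξ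
  refine eq_exp_mul_of_hasDerivAt (a := fun s => transComp ξ (v s) j) (fun s => ?_) t
  refine ((h.velocity s j).sub (((h.isLongitudinalPair hξ).velocity s).const_mul
    (ξ j / ‖ξ‖ : ℂ))).congr_deriv ?_
  rw [transComp, longComp]
  push_cast
  field_simp
  ring

lemma profile_eq (hξ : ξ ≠ 0) (P : Fin n → ℝ) (Q : ℝ) (j : Fin n) :
    profile α β γ P Q t ξ j = Real.exp (-(α * ‖ξ‖ ^ 2) * t) * transComp ξ (fun k => (P k : ℂ)) j
      + ξ j / ‖ξ‖ * dampedWave (α + β) γ ‖ξ‖ t (longComp ξ fun k => (P k : ℂ)) Q := by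
  have hne := norm_ofReal_ne_zero hξ
  have hexp : -(α + β) * ‖ξ‖ ^ 2 * t / 2 = -((α + β) / 2 * ‖ξ‖ ^ 2 * t) := by ring
  have hexp' : -α * ‖ξ‖ ^ 2 * t = -(α * ‖ξ‖ ^ 2) * t := by ring
  rw [profile, transComp, dampedWave, longComp, freqDot_ofReal, hexp, hexp']
  push_cast
  field_simp
  ring

lemma IsModeSolution.sum_sq_norm_sub_profile_eq {ρ : ℝ → ℂ} {v : ℝ → Fin n → ℂ}
    (h : IsModeSolution α β γ ξ ρ v) (hξ : ξ ≠ 0) (P : Fin n → ℝ) (Q t : ℝ) :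
    ∑ j, ‖v t j - profile α β γ P Q t ξ j‖ ^ 2 =
      Real.exp (-(α * ‖ξ‖ ^ 2) * t) ^ 2 * ∑ j, ‖transComp ξ (v 0 - fun k => (P k : ℂ)) j‖ ^ 2
        + ‖longComp ξ (v t)
            - dampedWave (α + β) γ ‖ξ‖ t (longComp ξ fun k => (P k : ℂ)) Q‖ ^ 2 := by
  have hdot : freqDot ξ (fun j => (Real.exp (-(α * ‖ξ‖ ^ 2) * t) : ℂ) *
      transComp ξ (v 0 - fun k => (P k : ℂ)) j) = 0 := by
    rw [freqDot_const_mul, freqDot_transComp hξ, mul_zero]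
  have hsplit (j : Fin n) : v t j - profile α β γ P Q t ξ j =
      Real.exp (-(α * ‖ξ‖ ^ 2) * t) * transComp ξ (v 0 - fun k => (P k : ℂ)) j
        + ξ j / ‖ξ‖ * (longComp ξ (v t)
            - dampedWave (α + β) γ ‖ξ‖ t (longComp ξ fun k => (P k : ℂ)) Q) := by
    rw [← transComp_add_longComp ξ (v t) j, h.transComp_eq hξ, profile_eq hξ, transComp_sub]
    ring
  simp only [hsplit, sum_sq_norm_add_longitudinal hξ hdot, norm_mul, mul_pow, ← Finset.mul_sum,
    Complex.norm_real, Real.norm_eq_abs, sq_abs]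

/-- The counterpart of `IsNearMean` for the whole velocity vector, at the frequency `ξ`: the means
`P` and `Q` are the values of the transformed data at frequency zero. -/
structure IsNearMeanAt (ξ : Sp n) (S : ℝ) (v₀ : Fin n → ℂ) (ρ₀ : ℂ) (P : Fin n → ℝ)
    (Q : ℝ) : Prop where
  sum_sq_velocity_le : ∑ j, ‖v₀ j‖ ^ 2 ≤ S ^ 2
  sum_sq_velocity_mean_le : ∑ j, ‖(P j : ℂ)‖ ^ 2 ≤ S ^ 2
  norm_density_mean_le : ‖(Q : ℂ)‖ ≤ S
  sum_sq_velocity_sub_le : ∑ j, ‖v₀ j - P j‖ ^ 2 ≤ (‖ξ‖ * S) ^ 2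
  norm_density_sub_le : ‖ρ₀ - Q‖ ≤ ‖ξ‖ * S

lemma IsNearMeanAt.isNearMean {v₀ : Fin n → ℂ} {ρ₀ : ℂ} {P : Fin n → ℝ} {Q : ℝ}
    (h : IsNearMeanAt ξ S v₀ ρ₀ P Q) (hξ : ξ ≠ 0) :
    IsNearMean ‖ξ‖ S (longComp ξ v₀) ρ₀ (longComp ξ fun k => (P k : ℂ)) Q := by
  have hS : 0 ≤ S := (norm_nonneg _).trans h.norm_density_mean_le
  refine ⟨(sq_le_sq₀ (norm_nonneg _) hS).1 ?_, (sq_le_sq₀ (norm_nonneg _) hS).1 ?_,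
    h.norm_density_mean_le, (sq_le_sq₀ (norm_nonneg _) (by positivity)).1 ?_, h.norm_density_sub_le⟩
  · exact (sq_norm_longComp_le hξ _).trans h.sum_sq_velocity_le
  · exact (sq_norm_longComp_le hξ _).trans h.sum_sq_velocity_mean_le
  · rw [← longComp_sub]
    exact (sq_norm_longComp_le hξ _).trans h.sum_sq_velocity_sub_le

lemma exists_mode_bound (hα : 0 < α) (hαβ : 0 < α + β) (hγ : 0 < γ) :
    ∃ b C η : ℝ, 0 < b ∧ 0 < C ∧ 0 < η ∧ ∀ {n : ℕ} {ξ : Sp n} {ρ : ℝ → ℂ} {v : ℝ → Fin n → ℂ}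
      {P : Fin n → ℝ} {Q S t : ℝ}, IsModeSolution α β γ ξ ρ v → ξ ≠ 0 → 0 ≤ t →
      IsNearMeanAt ξ S (v 0) (ρ 0) P Q →
      ∑ j, ‖v t j - profile α β γ P Q t ξ j‖ ^ 2 ≤
        C * ((‖ξ‖ * S) ^ 2 * Real.exp (-(b * ‖ξ‖ ^ 2 * t))
          + Real.exp (-η * t) * (∑ j, ‖v 0 j‖ ^ 2 + ‖ρ 0‖ ^ 2)) := by
  obtain ⟨C, η, hC, hη, hlong⟩ := exists_longitudinal_bound hαβ hγ
  set b := min α ((α + β) / 2)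
  have hb : 0 < b := by positivity
  refine ⟨b, C + 1, η, hb, by positivity, hη, fun {n ξ ρ v P Q S t} h hξ ht hm => ?_⟩
  set G := (‖ξ‖ * S) ^ 2 * Real.exp (-(b * ‖ξ‖ ^ 2 * t))
  set E := ∑ j, ‖v 0 j‖ ^ 2 + ‖ρ 0‖ ^ 2
  have htrans : Real.exp (-(α * ‖ξ‖ ^ 2) * t) ^ 2 *
      ∑ j, ‖transComp ξ (v 0 - fun k => (P k : ℂ)) j‖ ^ 2 ≤ G := by
    rw [mul_comm, ← Real.exp_nat_mul]
    refine mul_le_mul ((sum_sq_norm_transComp_le hξ _).trans hm.sum_sq_velocity_sub_le)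
      (Real.exp_le_exp.2 ?_) (by positivity) (by positivity)
    have hbα : b * ‖ξ‖ ^ 2 * t ≤ α * ‖ξ‖ ^ 2 * t := by gcongr; exact min_le_left _ _
    push_cast
    linarith [show 0 ≤ α * ‖ξ‖ ^ 2 * t by positivity]
  have hwave : ‖longComp ξ (v t)
      - dampedWave (α + β) γ ‖ξ‖ t (longComp ξ fun k => (P k : ℂ)) Q‖ ^ 2
      ≤ C * (G + Real.exp (-η * t) * E) := by
    refine (hlong (h.isLongitudinalPair hξ) (norm_pos_iff.2 hξ) ht (hm.isNearMean hξ)).trans ?_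
    simp only [G, E]
    gcongr
    exacts [min_le_right _ _, sq_norm_longComp_le hξ _]
  rw [h.sum_sq_norm_sub_profile_eq hξ]
  linarith [show 0 ≤ Real.exp (-η * t) * E by positivity]

end ModeSolution

section FourierIntegral

variable {n : ℕ} {f : Sp n → ℝ}

/-- The Fourier integral `∫ e^{-i x·ξ} f(x) dx`, obtained like `fourierL2` by rescaling the
frequency. -/
def fourierInt (f : Sp n → ℝ) (ξ : Sp n) : ℂ := 𝓕 (fun x => (f x : ℂ)) ((2 * Real.pi)⁻¹ • ξ)

lemma fourierInt_eq_integral (f : Sp n → ℝ) (ξ : Sp n) :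
    fourierInt f ξ = ∫ x, Complex.exp (Complex.I * (-inner ℝ x ξ : ℝ)) * f x := by
  rw [fourierInt, Real.fourier_eq']
  refine integral_congr_ae (.of_forall fun x => ?_)
  have hphase : -2 * Real.pi * inner ℝ x ((2 * Real.pi)⁻¹ • ξ) = -inner ℝ x ξ := by
    rw [inner_smul_right]
    field_simp
  simp only [hphase, smul_eq_mul, mul_comm Complex.I]

lemma ae_fourier_toC_eq {g : L2 n} (hg : g =ᵐ[volume] f) (hf : Integrable f) :
    (𝓕 (toC g) : CL2 n) =ᵐ[volume] 𝓕 (fun x => (f x : ℂ)) := by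
  have hf' : Integrable fun x => (f x : ℂ) := hf.ofReal
  have hcont : Continuous (𝓕 (fun x => (f x : ℂ))) :=
    VectorFourier.fourierIntegral_continuous Real.continuous_fourierChar
      (L := innerₗ (Sp n)) continuous_inner hf'
  refine ae_eq_of_integral_contDiff_smul_eq
    ((Lp.memLp (𝓕 (toC g) : CL2 n)).locallyIntegrable one_le_two) hcont.locallyIntegrable ?_
  intro h hh hhc
  let φ : 𝓢(Sp n, ℂ) := (hhc.comp_left Complex.ofReal_zero).toSchwartzMap
    (Complex.ofRealCLM.contDiff.comp hh)
  have hφ (x : Sp n) : φ x = h x := rfl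
  have hswap := VectorFourier.integral_fourierIntegral_smul_eq_flip (L := innerₗ (Sp n))
    (μ := volume) (ν := volume) Real.continuous_fourierChar continuous_inner hf' φ.integrable
  rw [flip_innerₗ] at hswap
  calc ∫ x, h x • (𝓕 (toC g) : CL2 n) x = pair g (𝓕 φ) := (pair_fourier g φ).symm
    _ = ∫ x, (f x : ℂ) • (𝓕 φ) x := integral_congr_ae <| by
        filter_upwards [hg] with x hx
        rw [hx, smul_eq_mul]
    _ = ∫ x, 𝓕 (fun x => (f x : ℂ)) x • φ x := hswap.symm
    _ = ∫ x, h x • 𝓕 (fun x => (f x : ℂ)) x := by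
        simp only [smul_eq_mul, mul_comm, hφ, Complex.real_smul]

lemma ae_fourierL2_eq {g : L2 n} (hg : g =ᵐ[volume] f) (hf : Integrable f) :
    ∀ᵐ ξ, fourierL2 g ξ = fourierInt f ξ :=
  (quasiMeasurePreserving_const_smul (by positivity)).ae (ae_fourier_toC_eq hg hf)

lemma integral_abs_le_norm11 (hf : MemL11 f) : ∫ x, |f x| ≤ norm11 f :=
  integral_mono hf.1.abs hf.2 fun x =>
    le_mul_of_one_le_left (abs_nonneg _) (le_add_of_nonneg_right (norm_nonneg x))

lemma sq_integral_le_sq_norm11 (hf : MemL11 f) : (∫ x, f x) ^ 2 ≤ norm11 f ^ 2 :=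
  sq_le_sq' (neg_le_of_abs_le (abs_integral_le_integral_abs.trans (integral_abs_le_norm11 hf)))
    (le_of_abs_le (abs_integral_le_integral_abs.trans (integral_abs_le_norm11 hf)))

lemma norm_fourierInt_le_norm11 (hf : MemL11 f) (ξ : Sp n) : ‖fourierInt f ξ‖ ≤ norm11 f := by
  refine (VectorFourier.norm_fourierIntegral_le_integral_norm _ _ _ _ _).trans ?_
  simpa using integral_abs_le_norm11 hf

lemma norm_fourierInt_sub_integral_le (hf : MemL11 f) (ξ : Sp n) :
    ‖fourierInt f ξ - (∫ x, f x : ℝ)‖ ≤ ‖ξ‖ * norm11 f := by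
  have hf' : Integrable fun x => (f x : ℂ) := hf.1.ofReal
  have hint : Integrable fun x => Complex.exp (Complex.I * (-inner ℝ x ξ : ℝ)) * f x := by
    refine hf'.mono ((Continuous.aestronglyMeasurable (by fun_prop)).mul
      hf'.aestronglyMeasurable) (.of_forall fun x => ?_)
    rw [norm_mul, mul_comm Complex.I, Complex.norm_exp_ofReal_mul_I, one_mul]
  have hphase (x : Sp n) : ‖Complex.exp (Complex.I * (-inner ℝ x ξ : ℝ)) - 1‖
      ≤ ‖ξ‖ * (1 + ‖x‖) := by
    calc ‖Complex.exp (Complex.I * (-inner ℝ x ξ : ℝ)) - 1‖ ≤ ‖-inner ℝ x ξ‖ :=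
          Real.norm_exp_I_mul_ofReal_sub_one_le
      _ ≤ ‖x‖ * ‖ξ‖ := by
          rw [norm_neg]
          exact norm_inner_le_norm x ξ
      _ ≤ ‖ξ‖ * (1 + ‖x‖) := by linarith [norm_nonneg ξ]
  rw [fourierInt_eq_integral, ← integral_complex_ofReal, ← integral_sub hint hf', norm11,
    ← integral_const_mul]
  refine norm_integral_le_of_norm_le (hf.2.const_mul _) (.of_forall fun x => ?_)
  rw [← sub_one_mul, norm_mul, Complex.norm_real, Real.norm_eq_abs, ← mul_assoc]
  gcongr
  exact hphase x

lemma isNearMeanAt_fourierInt {ρ₀ : Sp n → ℝ} {v₀ : Fin n → Sp n → ℝ} (hρ₀ : MemL11 ρ₀)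
    (hv₀ : ∀ j, MemL11 (v₀ j)) (ξ : Sp n) :
    IsNearMeanAt ξ √(∑ j, norm11 (v₀ j) ^ 2 + norm11 ρ₀ ^ 2) (fun j => fourierInt (v₀ j) ξ)
      (fourierInt ρ₀ ξ) (fun j => ∫ x, v₀ j x) (∫ x, ρ₀ x) := by
  have hvel : ∑ j, norm11 (v₀ j) ^ 2 ≤ √(∑ j, norm11 (v₀ j) ^ 2 + norm11 ρ₀ ^ 2) ^ 2 := by
    rw [Real.sq_sqrt (by positivity)]
    exact le_add_of_nonneg_right (sq_nonneg _)
  have hden : norm11 ρ₀ ≤ √(∑ j, norm11 (v₀ j) ^ 2 + norm11 ρ₀ ^ 2) :=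
    Real.le_sqrt_of_sq_le (le_add_of_nonneg_left (by positivity))
  refine ⟨?_, ?_, ?_, ?_, ?_⟩
  · refine le_trans ?_ hvel
    gcongr with j
    exact norm_fourierInt_le_norm11 (hv₀ j) ξ
  · simp only [Complex.norm_real, Real.norm_eq_abs, sq_abs]
    exact (Finset.sum_le_sum fun j _ => sq_integral_le_sq_norm11 (hv₀ j)).trans hvel
  · rw [Complex.norm_real]
    exact (norm_integral_le_integral_norm _).trans ((integral_abs_le_norm11 hρ₀).trans hden)
  · rw [mul_pow]
    refine le_trans ?_ (mul_le_mul_of_nonneg_left hvel (sq_nonneg ‖ξ‖))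
    rw [Finset.mul_sum]
    simp only [← mul_pow]
    gcongr with j
    exact norm_fourierInt_sub_integral_le (hv₀ j) ξ
  · exact (norm_fourierInt_sub_integral_le hρ₀ ξ).trans (by gcongr)

end FourierIntegral

section Plancherel

variable {n : ℕ} {f : L2 n} {f₀ : Sp n → ℝ}

lemma norm_toC (f : L2 n) : ‖toC f‖ = ‖f‖ := by
  rw [Lp.norm_def, Lp.norm_def]
  refine congrArg ENNReal.toReal (eLpNorm_congr_norm_ae ?_)
  filter_upwards [coeFn_toC f] with x hx
  rw [hx, Complex.norm_real]

lemma integral_sq_norm_coeFn (F : CL2 n) : ∫ x, ‖F x‖ ^ 2 = ‖F‖ ^ 2 := by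
  have h := L2.inner_def (𝕜 := ℂ) F F
  simp only [inner_self_eq_norm_sq_to_K, Complex.coe_algebraMap] at h
  norm_cast at h
  exact h.symm

lemma integrable_sq_norm_fourierL2 (f : L2 n) : Integrable fun ξ => ‖fourierL2 f ξ‖ ^ 2 := by
  have h := (memLp_two_iff_integrable_sq_norm (Lp.memLp (𝓕 (toC f) : CL2 n)).1).1 (Lp.memLp _)
  exact h.comp_smul (inv_ne_zero (by positivity))

lemma integral_sq_norm_fourierL2 (hf : f =ᵐ[volume] f₀) :
    ∫ ξ, ‖fourierL2 f ξ‖ ^ 2 = (2 * Real.pi) ^ n * norm2 f₀ ^ 2 := by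
  have h := Measure.integral_comp_smul volume (fun x => ‖(𝓕 (toC f) : CL2 n) x‖ ^ 2)
    (2 * Real.pi)⁻¹
  rwa [finrank_euclideanSpace_fin, integral_sq_norm_coeFn, Lp.norm_fourier_eq, norm_toC,
    Lp.norm_def, eLpNorm_congr_ae hf, inv_pow, inv_inv, abs_of_nonneg (by positivity),
    smul_eq_mul] at h

lemma aestronglyMeasurable_fourierL2 (f : L2 n) : AEStronglyMeasurable (fourierL2 f) volume :=
  (Lp.aestronglyMeasurable (𝓕 (toC f) : CL2 n)).comp_quasiMeasurePreserving
    (quasiMeasurePreserving_const_smul (by positivity))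

end Plancherel

section Gaussian

variable {n : ℕ} {b t : ℝ}

lemma integrable_exp_neg_mul_sq_norm (hb : 0 < b) :
    Integrable fun ξ : Sp n => Real.exp (-b * ‖ξ‖ ^ 2) :=
  .of_integral_ne_zero <| by
    rw [GaussianFourier.integral_rexp_neg_mul_sq_norm hb]
    positivity

lemma sq_norm_mul_exp_le (hb : 0 < b) (ht : 0 < t) (ξ : Sp n) :
    ‖ξ‖ ^ 2 * Real.exp (-(b * ‖ξ‖ ^ 2 * t))
      ≤ 2 / (b * t) * Real.exp (-(b * t / 2) * ‖ξ‖ ^ 2) := by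
  have hsq : ‖ξ‖ ^ 2 ≤ 2 / (b * t) * Real.exp (b * t / 2 * ‖ξ‖ ^ 2) := by
    calc ‖ξ‖ ^ 2 = 2 / (b * t) * (b * t / 2 * ‖ξ‖ ^ 2) := by field_simp
      _ ≤ 2 / (b * t) * Real.exp (b * t / 2 * ‖ξ‖ ^ 2) := by
          gcongr
          linarith [Real.add_one_le_exp (b * t / 2 * ‖ξ‖ ^ 2)]
  calc _ ≤ 2 / (b * t) * Real.exp (b * t / 2 * ‖ξ‖ ^ 2) * Real.exp (-(b * ‖ξ‖ ^ 2 * t)) := by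
        gcongr
    _ = _ := by
        rw [mul_assoc, ← Real.exp_add]
        ring_nf

lemma integrable_sq_norm_mul_exp (hb : 0 < b) (ht : 0 < t) :
    Integrable fun ξ : Sp n => ‖ξ‖ ^ 2 * Real.exp (-(b * ‖ξ‖ ^ 2 * t)) :=
  ((integrable_exp_neg_mul_sq_norm (by positivity : 0 < b * t / 2)).const_mul
    (2 / (b * t))).mono' (by fun_prop) <| .of_forall fun ξ => by
      rw [Real.norm_of_nonneg (by positivity)]
      exact sq_norm_mul_exp_le hb ht ξ

lemma integral_sq_norm_mul_exp_le (hb : 0 < b) (ht : 0 < t) :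
    ∫ ξ : Sp n, ‖ξ‖ ^ 2 * Real.exp (-(b * ‖ξ‖ ^ 2 * t))
      ≤ 2 / b * (2 * Real.pi / b) ^ ((n : ℝ) / 2) * t ^ (-(n : ℝ) / 2 - 1) := by
  have hbt : 0 < b * t / 2 := by positivity
  have hscale : Real.pi / (b * t / 2) = 2 * Real.pi / b * t⁻¹ := by field_simp
  calc _ ≤ ∫ ξ : Sp n, 2 / (b * t) * Real.exp (-(b * t / 2) * ‖ξ‖ ^ 2) :=
        integral_mono (integrable_sq_norm_mul_exp hb ht)
          ((integrable_exp_neg_mul_sq_norm hbt).const_mul _) (sq_norm_mul_exp_le hb ht)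
    _ = 2 / (b * t) * ((2 * Real.pi / b) ^ ((n : ℝ) / 2) * t ^ (-((n : ℝ) / 2))) := by
        rw [integral_const_mul, GaussianFourier.integral_rexp_neg_mul_sq_norm hbt,
          finrank_euclideanSpace_fin, hscale, Real.mul_rpow (by positivity) (by positivity),
          Real.inv_rpow ht.le, Real.rpow_neg ht.le]
    _ = _ := by
        rw [neg_div, Real.rpow_sub_one ht.ne']
        field_simp

end Gaussian

section Error

variable {n : ℕ} {α β γ : ℝ}

lemma exists_ae_errorSq_le (hα : 0 < α) (hαβ : 0 < α + β) (hγ : 0 < γ) :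
    ∃ b C η : ℝ, 0 < b ∧ 0 < C ∧ 0 < η ∧ ∀ {n : ℕ} {ρ₀ : Sp n → ℝ} {v₀ : Fin n → Sp n → ℝ}
      {ρ : ℝ → L2 n} {v : ℝ → Fin n → L2 n} {t : ℝ}, MemL11 ρ₀ → (∀ j, MemL11 (v₀ j)) →
      IsSolution α β γ ρ₀ v₀ ρ v → 0 ≤ t → ∀ᵐ ξ, errorSq α β γ ρ₀ v₀ (v t) t ξ ≤
        C * ((∑ j, norm11 (v₀ j) ^ 2 + norm11 ρ₀ ^ 2) *
            (‖ξ‖ ^ 2 * Real.exp (-(b * ‖ξ‖ ^ 2 * t)))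
          + Real.exp (-η * t) *
            (∑ j, ‖fourierL2 (v 0 j) ξ‖ ^ 2 + ‖fourierL2 (ρ 0) ξ‖ ^ 2)) := by
  obtain ⟨b, C, η, hb, hC, hη, hmode⟩ := exists_mode_bound hα hαβ hγ
  refine ⟨b, C, η, hb, hC, hη, fun {n ρ₀ v₀ ρ v t} hρ₀ hv₀ h ht => ?_⟩
  rcases isEmpty_or_nonempty (Fin n) with _ | _
  · refine .of_forall fun ξ => ?_
    rw [errorSq, Finset.sum_of_isEmpty]
    positivity
  filter_upwards [h.ae_exists_isModeSolution ht, Measure.ae_ne volume 0,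
    ae_fourierL2_eq h.initial_density hρ₀.1,
    ae_all_iff.2 fun j => ae_fourierL2_eq (h.initial_velocity j) (hv₀ j).1]
    with ξ ⟨a, w, hsol, ha, hw, hwt⟩ hξ hρξ hvξ
  have hnear := isNearMeanAt_fourierInt hρ₀ hv₀ ξ
  simp only [← hρξ, ← hvξ, ← ha, ← hw] at hnear
  have hbound := hmode hsol hξ ht hnear
  rw [mul_pow, Real.sq_sqrt (by positivity), mul_comm (‖ξ‖ ^ 2), mul_assoc] at hbound
  simpa only [errorSq, ha, hw, hwt] using hbound

lemma aestronglyMeasurable_errorSq (α β γ : ℝ) (ρ₀ : Sp n → ℝ) (v₀ : Fin n → Sp n → ℝ)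
    (w : Fin n → L2 n) (t : ℝ) :
    AEStronglyMeasurable (errorSq α β γ ρ₀ v₀ w t) volume := by
  refine Finset.aestronglyMeasurable_fun_sum _ fun j _ => ?_
  have hprofile : Measurable fun ξ =>
      profile α β γ (fun k => ∫ x, v₀ k x) (∫ x, ρ₀ x) t ξ j := by
    unfold profile
    fun_prop
  exact ((aestronglyMeasurable_fourierL2 (w j)).sub hprofile.aestronglyMeasurable).norm.pow 2

lemma integrable_initial_energy (r : L2 n) (w : Fin n → L2 n) :
    Integrable fun ξ => ∑ j, ‖fourierL2 (w j) ξ‖ ^ 2 + ‖fourierL2 r ξ‖ ^ 2 :=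
  (integrable_finsetSum _ fun j _ => integrable_sq_norm_fourierL2 (w j)).add
    (integrable_sq_norm_fourierL2 r)

lemma IsSolution.integral_initial_energy {ρ₀ : Sp n → ℝ} {v₀ : Fin n → Sp n → ℝ}
    {ρ : ℝ → L2 n} {v : ℝ → Fin n → L2 n} (h : IsSolution α β γ ρ₀ v₀ ρ v) :
    ∫ ξ, (∑ j, ‖fourierL2 (v 0 j) ξ‖ ^ 2 + ‖fourierL2 (ρ 0) ξ‖ ^ 2)
      = (2 * Real.pi) ^ n * (∑ j, norm2 (v₀ j) ^ 2 + norm2 ρ₀ ^ 2) := by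
  rw [integral_add (integrable_finsetSum _ fun j _ => integrable_sq_norm_fourierL2 (v 0 j))
      (integrable_sq_norm_fourierL2 (ρ 0)),
    integral_finsetSum _ fun j _ => integrable_sq_norm_fourierL2 (v 0 j),
    integral_sq_norm_fourierL2 h.initial_density,
    Finset.sum_congr rfl fun j _ => integral_sq_norm_fourierL2 (h.initial_velocity j),
    ← Finset.mul_sum, mul_add]

theorem theorem1p2_general (n : ℕ) (hα : 0 < α) (hαβ : 0 < α + β) (hγ : 0 < γ) :
    ∃ C η : ℝ, 0 < C ∧ 0 < η ∧ ∀ (ρ₀ : Sp n → ℝ) (v₀ : Fin n → Sp n → ℝ), MemL11 ρ₀ →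
      (∀ j, MemL11 (v₀ j)) → ∀ (ρ : ℝ → L2 n) (v : ℝ → Fin n → L2 n),
      IsSolution α β γ ρ₀ v₀ ρ v → ∀ t, 0 < t → Integrable (errorSq α β γ ρ₀ v₀ (v t) t) ∧
        ∫ ξ, errorSq α β γ ρ₀ v₀ (v t) t ξ ≤
          C * (∑ j, norm11 (v₀ j) ^ 2 + norm11 ρ₀ ^ 2) * t ^ (-(n : ℝ) / 2 - 1)
            + C * Real.exp (-η * t) * (∑ j, norm2 (v₀ j) ^ 2 + norm2 ρ₀ ^ 2) := by
  obtain ⟨b, C, η, hb, hC, hη, hpointwise⟩ := exists_ae_errorSq_le hα hαβ hγ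
  set K := 2 / b * (2 * Real.pi / b) ^ ((n : ℝ) / 2)
  refine ⟨C * max K ((2 * Real.pi) ^ n), η, by positivity, hη,
    fun ρ₀ v₀ hρ₀ hv₀ ρ v h t ht => ?_⟩
  set X := ∑ j, norm11 (v₀ j) ^ 2 + norm11 ρ₀ ^ 2
  set Y := ∑ j, norm2 (v₀ j) ^ 2 + norm2 ρ₀ ^ 2
  have hle := hpointwise hρ₀ hv₀ h ht.le
  have hgauss := (integrable_sq_norm_mul_exp (n := n) hb ht).const_mul X
  have henergy := (integrable_initial_energy (ρ 0) (v 0)).const_mul (Real.exp (-η * t))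
  have hmajorant := (hgauss.add henergy).const_mul C
  have hint : Integrable (errorSq α β γ ρ₀ v₀ (v t) t) :=
    hmajorant.mono' (aestronglyMeasurable_errorSq α β γ ρ₀ v₀ (v t) t) <| by
      filter_upwards [hle] with ξ hξ
      rwa [Real.norm_of_nonneg (by unfold errorSq; positivity)]
  refine ⟨hint, ?_⟩
  calc ∫ ξ, errorSq α β γ ρ₀ v₀ (v t) t ξ
      ≤ C * (X * (K * t ^ (-(n : ℝ) / 2 - 1)) + Real.exp (-η * t) * ((2 * Real.pi) ^ n * Y)) := by
        refine (integral_mono_ae hint hmajorant hle).trans ?_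
        rw [integral_const_mul]
        gcongr
        refine (integral_add hgauss henergy).trans_le ?_
        rw [integral_const_mul, integral_const_mul, h.integral_initial_energy]
        gcongr
        exact integral_sq_norm_mul_exp_le hb ht
    _ = C * K * X * t ^ (-(n : ℝ) / 2 - 1) + C * (2 * Real.pi) ^ n * Real.exp (-η * t) * Y := by
        ring
    _ ≤ _ := by
        gcongr
        exacts [le_max_left _ _, le_max_right _ _]

end Error

end LinNS

end

theorem theorem1p2 (n : ℕ) (hn : 2 ≤ n) (α β γ : ℝ) (hα : 0 < α) (hβ : 0 ≤ β) (hγ : 0 < γ) :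
    ∃ C η T : ℝ, 0 < C ∧ 0 < η ∧ 0 < T ∧
      ∀ (ρ₀ : LinNS.Sp n → ℝ) (v₀ : Fin n → LinNS.Sp n → ℝ),
        LinNS.MemL11 ρ₀ → MemLp ρ₀ 2 volume →
        (∀ j, LinNS.MemL11 (v₀ j)) → (∀ j, MemLp (v₀ j) 2 volume) →
        ∀ (ρ : ℝ → LinNS.L2 n) (v : ℝ → Fin n → LinNS.L2 n),
          LinNS.IsSolution α β γ ρ₀ v₀ ρ v →
          ∀ t : ℝ, T ≤ t →
            Integrable (fun ξ => LinNS.errorSq α β γ ρ₀ v₀ (v t) t ξ) ∧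
            ∫ ξ, LinNS.errorSq α β γ ρ₀ v₀ (v t) t ξ ≤
              C * ((∑ j, (∫ x, v₀ j x) ^ 2) + (∫ x, ρ₀ x) ^ 2
                  + (∑ j, LinNS.norm11 (v₀ j) ^ 2) + LinNS.norm11 ρ₀ ^ 2)
                * t ^ (-(n : ℝ) / 2 - 1)
              + C * Real.exp (-η * t)
                * ((∑ j, LinNS.norm2 (v₀ j) ^ 2) + LinNS.norm2 ρ₀ ^ 2) := by
  obtain ⟨C, η, hC, hη, h⟩ := LinNS.theorem1p2_general n hα (add_pos_of_pos_of_nonneg hα hβ) hγ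
  refine ⟨C, η, 1, hC, hη, one_pos, fun ρ₀ v₀ hρ₀ _ hv₀ _ ρ v hsol t ht => ?_⟩
  have ht₀ := one_pos.trans_le ht
  obtain ⟨hint, hle⟩ := h ρ₀ v₀ hρ₀ hv₀ ρ v hsol t ht₀
  refine ⟨hint, hle.trans ?_⟩
  gcongr
  linarith [sq_nonneg (∫ x, ρ₀ x),
    Finset.sum_nonneg (s := Finset.univ) fun j _ => sq_nonneg (∫ x, v₀ j x)]
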